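/- Let $m=2u\ge 4$ be even, let $n=2^m-1$, let $\mathbb F_{2^u}\subset\mathbb F_{2^m}$, and let $\alpha$ be a primitive element of $\mathbb F_{2^m}$, so that every $x\in\mathbb F_{2^m}$ is uniquely $x=x_1+x_2\alpha$ with $x_1,x_2\in\mathbb F_{2^u}$. Index the coordinates of $\mathbb F_2^n$ by the nonzero elements of $\mathbb F_{2^m}$. Let $C^{(u)}$ be the binary linear code of all $v\in\mathbb F_2^n$ with $\sum_x v_x x=0$ and $\sum_x v_x x^{2^u+1}=0$, and put $S(v)=\sum_x v_x x_1x_2\in\mathbb F_{2^u}$. Let $v_1,\dots,v_u\in\mathbb F_2^n$ be vectors such that each coset $C^{(u)}+v_k$ has minimum weight $3$ and $S(v_1),\dots,S(v_u)$ are linearly independent over $\mathbb F_2$. For $0\le i\le u$ let $C^{(i)}=\langle C^{(u)},v_1,\dots,v_{u-i}\rangle$, and let $\Gamma^{(i)}$ be the coset graph of $C^{(i)}$: its vertices are the cosets of $C^{(i)}$ in $\mathbb F_2^n$, two different cosets being adjacent if they contain vectors at Hamming distance $1$. Such $v_1,\dots,v_u$ exist, and for every choice of them the following hold. 1. For $0\le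 i\le u$, the graph $\Gamma^{(i)}$ has $2^{2u+i}$ vertices. 2. $\Gamma^{(0)}$ is the complete graph $K_{2^m}$; it has diameter $1$. 3. For $1\le i\le u$, the graph $\Gamma^{(i)}$ is an antipodal distance-regular graph (being equal or at maximum distance is an equivalence relation on its vertices) of diameter $3$ with intersection array $$(2^m-1,\;2^m-2^{m-i},\;1;\;1,\;2^{m-i},\;2^m-1).$$ 4. The graphs are nested: for $0\le j<i\le u$ we have $C^{(i)}\subset C^{(j)}$, and the natural projection $x+C^{(i)}\mapsto x+C^{(j)}$ is a covering $\Gamma^{(i)}\to\Gamma^{(j)}$ (a surjection mapping the neighbours of each vertex bijectively onto the neighbours of its image) all of whose fibres have size $2^{i-j}$. For $j=0$ the fibres are exactly the antipodal classes of $\Gamma^{(i)}$, so that $\Gamma^{(i)}$ is an antipodal $2^i$-cover of $K_{2^m}$. 5. $\Gamma^{(i)}$ is distance-transitive for $i\in\{0,1,u\}$ and, when $m=6$, for all $i\in\{0,1,2,3\}$. -/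

import Mathlib

open scoped BigOperators

noncomputable section

namespace NestedCosetGraphs

/-! ### Graph notions -/

section Graphs

variable {V W : Type*}

/-- `G` is distance-regular with intersection array `(b₀, …, b_{D-1}; c₁, …, c_D)`, where `b` and `c`
are the lists `[b₀, …, b_{D-1}]` and `[c₁, …, c_D]`: `G` is connected of diameter `D` and, whenever
`y` is at distance `i` from `x`, it has exactly `b_i` neighbours at distance `i + 1` from `x`
and exactly `c_i` neighbours at distance `i - 1` from `x` (with `b_D = 0` and `c_0 = 0`).
The case `i = 0` says that `G` is regular of valency `b₀`. -/
structure IsDistanceRegular (G : SimpleGraph V) (b c : List ℕ) : Prop where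
  connected : G.Connected
  length_eq : b.length = c.length
  diameter : G.ediam = (b.length : ℕ∞)
  card_up : ∀ x y : V,
    {z | G.Adj y z ∧ G.dist x z = G.dist x y + 1}.ncard = b.getD (G.dist x y) 0
  card_down : ∀ x y : V,
    {z | G.Adj y z ∧ G.dist x z + 1 = G.dist x y}.ncard = (0 :: c).getD (G.dist x y) 0

/-- A connected graph in which any pair of vertices can be moved by an automorphism to any other
pair of vertices at the same distance. -/
def IsDistanceTransitive (G : SimpleGraph V) : Prop :=
  G.Connected ∧ ∀ x y x' y' : V, G.dist x y = G.dist x' y' →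
    ∃ φ : G ≃g G, φ x = x' ∧ φ y = y'

/-- A connected graph of diameter `D ≥ 3` for which the graph `Γ_D` (same vertices, two of them
adjacent when they are at distance `D`) is a disjoint union of cliques, that is, being equal or
adjacent in `Γ_D` is transitive. -/
def IsAntipodal (G : SimpleGraph V) : Prop :=
  G.Connected ∧ G.ediam ≠ ⊤ ∧ 3 ≤ G.diam ∧
    ∀ x y z : V, G.dist x y = G.diam → G.dist y z = G.diam → x ≠ z → G.dist x z = G.diam

/-- `f` is a covering of the graph `H` by the graph `G`, with all fibres of size `r`: a surjection
that maps the neighbours of every vertex `x` bijectively onto the neighbours of `f x`. -/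
structure IsGraphCovering (G : SimpleGraph V) (H : SimpleGraph W) (f : V → W) (r : ℕ) : Prop where
  surjective : Function.Surjective f
  bijOn : ∀ x : V, Set.BijOn f (G.neighborSet x) (H.neighborSet (f x))
  card_fibre : ∀ w : W, (f ⁻¹' {w}).Finite ∧ (f ⁻¹' {w}).ncard = r

end Graphs

/-! ### Binary linear codes and their coset graphs -/

section Codes

variable {ι : Type*} [Fintype ι]

/-- The coset graph of a binary linear code: the vertices are the cosets of `C`, and two different
cosets are adjacent when they contain vectors at Hamming distance one. -/
def cosetGraph (C : Submodule (ZMod 2) (ι → ZMod 2)) :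
    SimpleGraph ((ι → ZMod 2) ⧸ C) where
  Adj A B := A ≠ B ∧ ∃ x y : ι → ZMod 2,
    Submodule.Quotient.mk x = A ∧ Submodule.Quotient.mk y = B ∧ hammingDist x y = 1
  symm := ⟨by
    rintro A B ⟨h, x, y, hx, hy, hd⟩
    exact ⟨h.symm, y, x, hy, hx, by rwa [hammingDist_comm]⟩⟩
  loopless := ⟨fun _ h => h.1 rfl⟩

/-- The weight of the coset `C + v`: the least Hamming weight of its elements. -/
def cosetWeight (C : Submodule (ZMod 2) (ι → ZMod 2)) (v : ι → ZMod 2) : ℕ :=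
  sInf {w : ℕ | ∃ c ∈ C, hammingNorm (c + v) = w}

end Codes

/-! ### The codes

The field `F` has `2 ^ (2 * u)` elements, `K` is its subfield with `2 ^ u` elements, and the
`n = 2 ^ (2 * u) - 1` coordinate positions are the nonzero elements of `F`. -/

section Construction

variable (F : Type*) [Field F] [Fintype F] [DecidableEq F] [Algebra (ZMod 2) F]

/-- The binary vectors with positions indexed by the nonzero elements of `F`. -/
abbrev Word (F : Type*) [Field F] : Type _ := Fˣ → ZMod 2

/-- `v ↦ H v = ∑ v_x x`: the syndrome for the parity check matrix whose column at position `x`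
is `x`. -/
def syndromeH : Word F →ₗ[ZMod 2] F :=
  Fintype.linearCombination (ZMod 2) (fun x : Fˣ => (x : F))

/-- `v ↦ E v = ∑ v_x x ^ (2 ^ u + 1)`: the syndrome for the parity check matrix whose column at
position `x` is `x ^ (2 ^ u + 1)`. -/
def syndromeE (u : ℕ) : Word F →ₗ[ZMod 2] F :=
  Fintype.linearCombination (ZMod 2) (fun x : Fˣ => (x : F) ^ (2 ^ u + 1))

/-- The code with parity check matrix the vertical join of those of `syndromeH` and `syndromeE`. -/
def baseCode (u : ℕ) : Submodule (ZMod 2) (Word F) :=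
  LinearMap.ker (syndromeH F) ⊓ LinearMap.ker (syndromeE F u)

variable {F}
variable (K : Type*) [Field K] [Algebra K F]

/-- The coordinates `(x₁, x₂)` of `x = x₁ + x₂ α`, with `x₁` and `x₂` in `K`. -/
def coords (α : F) (x : F) : K × K :=
  Classical.epsilon fun p : K × K => x = algebraMap K F p.1 + algebraMap K F p.2 * α

/-- If `α` is a primitive element, the coordinates exist and are unique, so that `coords` is the
pair of coordinates with respect to the basis `1, α` of `F` over `K`. -/
theorem coords_eq_iff {F : Type*} [Field F] [Fintype F] (K : Type*) [Field K] [Fintype K]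
    [Algebra K F] {u : ℕ} (hu : 1 ≤ u)
    (hK : Fintype.card K = 2 ^ u) (hF : Fintype.card F = 2 ^ (2 * u))
    (α : Fˣ) (hα : ∀ x : Fˣ, x ∈ Subgroup.zpowers α) (x : F) (p : K × K) :
    coords K (α : F) x = p ↔ x = algebraMap K F p.1 + algebraMap K F p.2 * (α : F) := by
  classical
  have hnot : ∀ t : K, algebraMap K F t ≠ α := by
    intro t ht
    have ht0 : t ≠ 0 := by
      rintro rfl
      exact α.ne_zero (by rw [← ht, map_zero])
    have h1 : (α : F) ^ (2 ^ u - 1) = 1 := by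
      rw [← ht, ← map_pow, ← hK, FiniteField.pow_card_sub_one_eq_one t ht0, map_one]
    have h2 : α ^ (2 ^ u - 1) = 1 := Units.ext (by simpa using h1)
    have h3 : orderOf α = 2 ^ (2 * u) - 1 := by
      rw [orderOf_eq_card_of_forall_mem_zpowers hα, Nat.card_eq_fintype_card,
        Fintype.card_units, hF]
    have hlt : 2 ^ u < 2 ^ (2 * u) := Nat.pow_lt_pow_right (by norm_num) (by omega)
    have h2u : 2 ^ 1 ≤ 2 ^ u := Nat.pow_le_pow_right (by norm_num) hu
    have h4 := Nat.le_of_dvd (by omega) (orderOf_dvd_of_pow_eq_one h2)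
    omega
  let φ : K × K → F := fun p => algebraMap K F p.1 + algebraMap K F p.2 * (α : F)
  have hinj : Function.Injective φ := by
    rintro ⟨a, b⟩ ⟨c, d⟩ h
    have h' : algebraMap K F a + algebraMap K F b * (α : F)
        = algebraMap K F c + algebraMap K F d * (α : F) := h
    have hbd : b = d := by
      by_contra hne
      have hsub : algebraMap K F b - algebraMap K F d ≠ 0 := by
        rw [← map_sub]
        exact (map_ne_zero _).2 (sub_ne_zero.2 hne)
      apply hnot ((c - a) / (b - d))
      rw [map_div₀, map_sub, map_sub, div_eq_iff hsub]
      linear_combination -h'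
    subst hbd
    have hac : a = c := (algebraMap K F).injective (add_right_cancel h')
    rw [hac]
  have hbij : Function.Bijective φ := by
    rw [Fintype.bijective_iff_injective_and_card]
    refine ⟨hinj, ?_⟩
    rw [Fintype.card_prod, hK, hF]
    ring
  have hspec : x = φ (coords K (α : F) x) := by
    obtain ⟨q, hq⟩ := hbij.2 x
    exact Classical.epsilon_spec (p := fun p : K × K => x = φ p) ⟨q, hq.symm⟩
  constructor
  · rintro rfl
    exact hspec
  · intro h
    exact hinj (hspec.symm.trans h)

/-- `v ↦ S(v) = ∑ v_x x₁ x₂`, where `x = x₁ + x₂ α`. -/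
def quadS [Algebra (ZMod 2) K] (α : F) : Word F →ₗ[ZMod 2] K :=
  Fintype.linearCombination (ZMod 2)
    (fun x : Fˣ => (coords K α (x : F)).1 * (coords K α (x : F)).2)

/-- The vectors `v_1, …, v_u` from which a nested family is generated: their cosets modulo
`baseCode` have weight three, and `S(v_1), …, S(v_u)` are linearly independent over `𝔽₂`. -/
def IsGeneratingFamily [Algebra (ZMod 2) K] (u : ℕ) (α : F) (v : Fin u → Word F) : Prop :=
  (∀ k, cosetWeight (baseCode F u) (v k) = 3) ∧
    LinearIndependent (ZMod 2) (fun k => quadS K α (v k))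

/-- The code `C^{(i)}`, generated by `baseCode` and the first `u - i` of the vectors `v_k`. -/
def nestedCode (u : ℕ) (v : Fin u → Word F) (i : ℕ) : Submodule (ZMod 2) (Word F) :=
  baseCode F u ⊔ Submodule.span (ZMod 2) (v '' {k : Fin u | (k : ℕ) + i < u})

/-- The graph `Γ^{(i)}`, the coset graph of `C^{(i)}`. -/
def nestedGraph (u : ℕ) (v : Fin u → Word F) (i : ℕ) :
    SimpleGraph (Word F ⧸ nestedCode u v i) :=
  cosetGraph (nestedCode u v i)

end Construction

end NestedCosetGraphs

end

noncomputable section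

namespace NestedCosetGraphs

/-! ### Transport along graph isomorphisms -/

section Transport

variable {V W : Type*} {G : SimpleGraph V} {H : SimpleGraph W}

/-! Write `x = x₁ + x₂ α` and `Q(x) = x₁ x₂`. The norm `x ^ (2 ^ u + 1)` equals `x₁² + (α + α ^ 2 ^
u) x₁ x₂ + α ^ (2 ^ u + 1) x₂²`. Squaring is additive in characteristic two, so on words with `H w =
0` the second syndrome vanishes exactly when `S(w) = 0` (`mem_baseCode_iff`). Cosets of weight three
have `H = 0` (`cosetWeight_le_two`), so `C^{(i)}` consists of the words with `H w = 0` and `S(w) ∈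
W`, where `W` is the span of `u - i` independent values (`mem_nestedCode_iff`).

Cosets of `w` and `w'` with `x = H(w - w')` are adjacent when `x ≠ 0` and `S(w - w') ≡ Q(x)` modulo
`W`. Since `Q` polarises to the determinant on `K × K`, the map `w ↦ (H w, S(w) + Q(H w))`
identifies `Γ^{(i)}` with a graph on `(K × K) × (K ⧸ W)` in which `(x, a)` and `(y, b)` are adjacent
when `x ≠ y` and `a - b = det(x, y)` (`exists_cosetGraph_iso`).

For any alternating form whose maps `B x`, `x ≠ 0`, are onto, the distances and intersection numbers
of this graph come from counting solutions of one linear equation. Shrinking the value group gives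
the coverings. Translations and similitudes of the form give distance-transitivity as soon as the
multipliers are transitive on the nonzero values. -/

theorem edist_hom_le (φ : G →g H) (x y : V) : H.edist (φ x) (φ y) ≤ G.edist x y := by
  by_cases h : G.edist x y = ⊤
  · rw [h]; exact le_top
  · obtain ⟨p, hp⟩ := SimpleGraph.exists_walk_of_edist_ne_top h
    rw [← hp, ← SimpleGraph.Walk.length_map φ p]
    exact SimpleGraph.edist_le _

theorem edist_iso (φ : G ≃g H) (x y : V) : H.edist (φ x) (φ y) = G.edist x y := by
  refine le_antisymm (edist_hom_le φ.toHom x y) ?_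
  simpa using edist_hom_le φ.symm.toHom (φ x) (φ y)

theorem dist_iso (φ : G ≃g H) (x y : V) : H.dist (φ x) (φ y) = G.dist x y := by
  rw [SimpleGraph.dist, SimpleGraph.dist, edist_iso]

theorem ediam_iso (φ : G ≃g H) : G.ediam = H.ediam := by
  apply le_antisymm
  · refine SimpleGraph.ediam_le_of_edist_le fun x y => ?_
    rw [← edist_iso φ]
    exact SimpleGraph.edist_le_ediam
  · refine SimpleGraph.ediam_le_of_edist_le fun x y => ?_
    rw [← edist_iso φ.symm]
    exact SimpleGraph.edist_le_ediam

theorem diam_iso (φ : G ≃g H) : G.diam = H.diam := by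
  rw [SimpleGraph.diam, SimpleGraph.diam, ediam_iso φ]

theorem IsDistanceRegular.of_iso (φ : G ≃g H) {b c : List ℕ} (h : IsDistanceRegular H b c) :
    IsDistanceRegular G b c where
  connected := φ.connected_iff.2 h.connected
  length_eq := h.length_eq
  diameter := (ediam_iso φ).trans h.diameter
  card_up x y := by
    rw [← dist_iso φ x y, ← h.card_up (φ x) (φ y), ← Set.ncard_image_of_injective _ φ.injective]
    congr 1
    ext z
    obtain ⟨z, rfl⟩ := φ.surjective z
    simp [φ.injective.mem_set_image, dist_iso φ, φ.map_adj_iff]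
  card_down x y := by
    rw [← dist_iso φ x y, ← h.card_down (φ x) (φ y), ← Set.ncard_image_of_injective _ φ.injective]
    congr 1
    ext z
    obtain ⟨z, rfl⟩ := φ.surjective z
    simp [φ.injective.mem_set_image, dist_iso φ, φ.map_adj_iff]

theorem IsDistanceTransitive.of_iso (φ : G ≃g H) (h : IsDistanceTransitive H) :
    IsDistanceTransitive G := by
  refine ⟨φ.connected_iff.2 h.1, fun x y x' y' hd => ?_⟩
  obtain ⟨ψ, h1, h2⟩ := h.2 (φ x) (φ y) (φ x') (φ y') (by simpa only [dist_iso φ] using hd)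
  exact ⟨(φ.trans ψ).trans φ.symm, by simp [h1], by simp [h2]⟩

theorem IsAntipodal.of_iso (φ : G ≃g H) (h : IsAntipodal H) : IsAntipodal G := by
  obtain ⟨h1, h2, h3, h4⟩ := h
  refine ⟨φ.connected_iff.2 h1, by rwa [ediam_iso φ], by rwa [diam_iso φ], fun x y z => ?_⟩
  have := h4 (φ x) (φ y) (φ z)
  simpa only [dist_iso φ, diam_iso φ, ne_eq, φ.injective.eq_iff] using this

theorem IsGraphCovering.of_iso {V' W' : Type*} {G' : SimpleGraph V'} {H' : SimpleGraph W'}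
    (φ : G ≃g G') (ψ : H ≃g H') {f : V → W} {f' : V' → W'} {r : ℕ}
    (hf : ∀ x, ψ (f x) = f' (φ x)) (h : IsGraphCovering G' H' f' r) :
    IsGraphCovering G H f r := by
  have hf' : f = ψ.symm ∘ f' ∘ φ := by
    funext x
    simp [← hf]
  refine ⟨?_, fun x => ?_, fun w => ?_⟩
  · rw [hf']
    exact ψ.symm.surjective.comp (h.surjective.comp φ.surjective)
  · have hb := h.bijOn (φ x)
    refine ⟨fun y hy => ?_, fun y hy z hz hyz => ?_, fun w hw => ?_⟩
    · have := hb.mapsTo (φ.map_adj_iff.2 hy)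
      rw [SimpleGraph.mem_neighborSet, ← hf, ← hf] at this
      exact ψ.map_adj_iff.1 this
    · refine φ.injective (hb.injOn (φ.map_adj_iff.2 hy) (φ.map_adj_iff.2 hz) ?_)
      rw [← hf, ← hf, hyz]
    · have : ψ w ∈ H'.neighborSet (f' (φ x)) := by
        rw [SimpleGraph.mem_neighborSet, ← hf]
        exact ψ.map_adj_iff.2 hw
      obtain ⟨z, hz, hzw⟩ := hb.surjOn this
      obtain ⟨z, rfl⟩ := φ.surjective z
      exact ⟨z, φ.map_adj_iff.1 hz, ψ.injective ((hf z).trans hzw)⟩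
  · have hs : φ '' (f ⁻¹' {w}) = f' ⁻¹' {ψ w} := by
      ext z
      obtain ⟨z, rfl⟩ := φ.surjective z
      simp [φ.injective.mem_set_image, ← hf]
    obtain ⟨h1, h2⟩ := h.card_fibre (ψ w)
    rw [← hs] at h1 h2
    exact ⟨h1.of_finite_image φ.injective.injOn,
      by rwa [Set.ncard_image_of_injective _ φ.injective] at h2⟩

end Transport

/-! ### The graph of an alternating form -/

section AltGraph

variable {V A : Type*} [AddCommGroup V] [AddCommGroup A]

/-- A nondegenerate alternating biadditive map `B : V × V → A`, in the strong sense that all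
the maps `B x` with `x ≠ 0` are onto. -/
structure IsNondegAlternating (B : V → V → A) : Prop where
  add_left : ∀ x y z, B (x + y) z = B x z + B y z
  add_right : ∀ x y z, B x (y + z) = B x y + B x z
  self : ∀ x, B x x = 0
  surj : ∀ x, x ≠ 0 → Function.Surjective (B x)

namespace IsNondegAlternating

variable {B : V → V → A}

theorem sub_left (hB : IsNondegAlternating B) (x y z : V) : B (x - y) z = B x z - B y z := by
  rw [eq_sub_iff_add_eq, ← hB.add_left, sub_add_cancel]

theorem sub_right (hB : IsNondegAlternating B) (x y z : V) : B x (y - z) = B x y - B x z := by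
  rw [eq_sub_iff_add_eq, ← hB.add_right, sub_add_cancel]

theorem zero_left (hB : IsNondegAlternating B) (x : V) : B 0 x = 0 := by
  rw [← sub_self x, hB.sub_left, sub_self]

theorem zero_right (hB : IsNondegAlternating B) (x : V) : B x 0 = 0 := by
  rw [← sub_self x, hB.sub_right, sub_self]

theorem neg_swap (hB : IsNondegAlternating B) (x y : V) : B y x = -B x y := by
  have h := hB.self (x + y)
  rw [hB.add_left, hB.add_right, hB.add_right, hB.self, hB.self, zero_add, add_zero] at h
  exact (neg_eq_of_add_eq_zero_right h).symm

/-- The fibres of the maps `B x` with `x ≠ 0` all have the same size. -/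
theorem ncard_fibre [Finite V] (hB : IsNondegAlternating B) {r : ℕ}
    (hr : r * Nat.card A = Nat.card V) {x : V} (hx : x ≠ 0) (a : A) :
    {w | B x w = a}.ncard = r := by
  let g : V →+ A := AddMonoidHom.mk' (B x) (hB.add_right x)
  have : Finite A := Finite.of_surjective g (hB.surj x hx)
  have h1 : Nat.card V = Nat.card A * Nat.card g.ker := by
    rw [AddSubgroup.card_eq_card_quotient_mul_card_addSubgroup g.ker,
      Nat.card_congr (QuotientAddGroup.quotientKerEquivOfSurjective g (hB.surj x hx)).toEquiv]
  have h2 : Nat.card g.ker = r := by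
    rw [← hr, mul_comm] at h1
    exact (Nat.eq_of_mul_eq_mul_left Nat.card_pos h1).symm
  obtain ⟨w₀, hw₀⟩ := hB.surj x hx a
  have h3 : {w | B x w = a} = (fun w => w₀ + w) '' (g.ker : Set V) := by
    ext w
    constructor
    · intro hw
      refine ⟨w - w₀, ?_, add_sub_cancel _ _⟩
      change B x (w - w₀) = 0
      rw [hB.sub_right, hw₀, hw, sub_self]
    · rintro ⟨k, hk, rfl⟩
      have hk' : B x k = 0 := hk
      change B x (w₀ + k) = a
      rw [hB.add_right, hk', hw₀, add_zero]
  rw [h3, Set.ncard_image_of_injective _ (add_right_injective w₀), ← h2]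
  rfl

end IsNondegAlternating

/-- The graph on `V × A` in which `(x, a)` and `(y, b)` are adjacent when `x ≠ y` and
`a - b = B x y`. -/
def altGraph {B : V → V → A} (hB : IsNondegAlternating B) : SimpleGraph (V × A) where
  Adj p q := p.1 ≠ q.1 ∧ p.2 - q.2 = B p.1 q.1
  symm := ⟨by
    rintro p q ⟨h1, h2⟩
    exact ⟨h1.symm, by rw [hB.neg_swap, ← h2, neg_sub]⟩⟩
  loopless := ⟨fun _ h => h.1 rfl⟩

namespace altGraph

variable {B : V → V → A} (hB : IsNondegAlternating B)

theorem adj_iff {p q : V × A} : (altGraph hB).Adj p q ↔ p.1 ≠ q.1 ∧ p.2 - q.2 = B p.1 q.1 :=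
  Iff.rfl

/-! ### Distances in the graph of an alternating form -/

/-- A common neighbour of `(x, a)` and `(y, b)` over `w` needs `a - b = B x w + B w y = B (x - y)
w`, which is solvable because `x ≠ y`. The excluded values `w = x` and `w = y` would both give `a -
b = B x y`. -/
theorem exists_adj_adj {p q : V × A} (h : p.1 ≠ q.1) (h' : p.2 - q.2 ≠ B p.1 q.1) :
    ∃ z, (altGraph hB).Adj p z ∧ (altGraph hB).Adj z q := by
  obtain ⟨x, a⟩ := p
  obtain ⟨y, b⟩ := q
  obtain ⟨w, hw⟩ := hB.surj (x - y) (sub_ne_zero.2 h) (a - b)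
  dsimp only at h h'
  refine ⟨(w, a - B x w), ⟨?_, by simp⟩, ⟨?_, ?_⟩⟩
  · rintro rfl
    apply h'
    rw [← hw, hB.sub_left, hB.self, hB.neg_swap, zero_sub, neg_neg]
  · rintro rfl
    apply h'
    rw [← hw, hB.sub_left, hB.self, sub_zero]
  · rw [hB.sub_left] at hw
    change a - B x w - b = B w y
    rw [hB.neg_swap y w, sub_right_comm, ← hw]
    abel

theorem exists_adj [Nontrivial V] (p : V × A) : ∃ z, (altGraph hB).Adj p z := by
  obtain ⟨w, hw⟩ := exists_ne p.1
  exact ⟨(w, p.2 - B p.1 w), hw.symm, by simp⟩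

theorem edist_le_two {p q : V × A} (h : p.1 ≠ q.1) : (altGraph hB).edist p q ≤ 2 := by
  by_cases h' : p.2 - q.2 = B p.1 q.1
  · rw [SimpleGraph.edist_eq_one_iff_adj.2 ((adj_iff hB).2 ⟨h, h'⟩)]
    exact one_le_two
  · obtain ⟨z, h1, h2⟩ := exists_adj_adj hB h h'
    exact SimpleGraph.edist_le (.cons h1 (.cons h2 .nil))

theorem edist_le_three [Nontrivial V] (p q : V × A) : (altGraph hB).edist p q ≤ 3 := by
  by_cases h : p.1 = q.1
  · obtain ⟨z, hz⟩ := exists_adj hB p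
    have h1 : (altGraph hB).edist p z = 1 := SimpleGraph.edist_eq_one_iff_adj.2 hz
    have h2 : (altGraph hB).edist z q ≤ 2 := edist_le_two hB fun h' => hz.1 (h.trans h'.symm)
    refine SimpleGraph.edist_triangle.trans ((add_le_add h1.le h2).trans ?_)
    norm_num
  · exact (edist_le_two hB h).trans (by norm_num)

theorem connected [Nontrivial V] : (altGraph hB).Connected where
  preconnected p q := SimpleGraph.edist_ne_top_iff_reachable.1 fun h => by
    simpa [h] using edist_le_three hB p q
  nonempty := ⟨0⟩

theorem dist_le_three [Nontrivial V] (p q : V × A) : (altGraph hB).dist p q ≤ 3 := by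
  have h := edist_le_three hB p q
  rw [← ((connected hB).preconnected p q).coe_dist_eq_edist] at h
  exact_mod_cast h

theorem dist_eq_zero_iff [Nontrivial V] {p q : V × A} : (altGraph hB).dist p q = 0 ↔ p = q :=
  (connected hB).dist_eq_zero_iff

theorem dist_eq_one_iff {p q : V × A} :
    (altGraph hB).dist p q = 1 ↔ p.1 ≠ q.1 ∧ p.2 - q.2 = B p.1 q.1 :=
  SimpleGraph.dist_eq_one_iff_adj

/-- A vertex has at most one neighbour with a given first coordinate, because adjacency then
determines the second. -/
theorem fst_ne_of_adj_adj {p z q : V × A} (h1 : (altGraph hB).Adj p z)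
    (h2 : (altGraph hB).Adj z q) (hpq : p ≠ q) : p.1 ≠ q.1 := by
  intro h
  apply hpq
  refine Prod.ext h ?_
  have e1 := h1.2
  have e2 := h2.2
  rw [← h, hB.neg_swap, ← e1] at e2
  simpa using e2.symm

theorem dist_eq_two_iff [Nontrivial V] {p q : V × A} :
    (altGraph hB).dist p q = 2 ↔ p.1 ≠ q.1 ∧ p.2 - q.2 ≠ B p.1 q.1 := by
  constructor
  · intro h
    obtain ⟨w, hw⟩ := (connected hB).exists_walk_length_eq_dist p q
    rw [h] at hw
    have hpq : p ≠ q := by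
      rintro rfl
      simp at h
    match w, hw with
    | .cons h1 (.cons h2 .nil), _ =>
      have h3 := fst_ne_of_adj_adj hB h1 h2 hpq
      refine ⟨h3, fun h4 => ?_⟩
      have := (dist_eq_one_iff hB).2 ⟨h3, h4⟩
      omega
  · rintro ⟨h1, h2⟩
    have h3 : (altGraph hB).dist p q ≤ 2 := by
      have h := edist_le_two hB h1
      rw [← ((connected hB).preconnected p q).coe_dist_eq_edist] at h
      exact_mod_cast h
    have h4 : (altGraph hB).dist p q ≠ 0 := fun h => h1 (by rw [(dist_eq_zero_iff hB).1 h])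
    have h5 : (altGraph hB).dist p q ≠ 1 := fun h => h2 ((dist_eq_one_iff hB).1 h).2
    omega

theorem dist_eq_three_iff [Nontrivial V] {p q : V × A} :
    (altGraph hB).dist p q = 3 ↔ p.1 = q.1 ∧ p ≠ q := by
  have h0 := dist_eq_zero_iff hB (p := p) (q := q)
  have h1 := dist_eq_one_iff hB (p := p) (q := q)
  have h2 := dist_eq_two_iff hB (p := p) (q := q)
  have h3 := dist_le_three hB p q
  constructor
  · intro h
    rw [h] at h0 h1 h2
    simp only [OfNat.ofNat_ne_zero, false_iff] at h0
    refine ⟨?_, h0⟩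
    by_contra h4
    by_cases h5 : p.2 - q.2 = B p.1 q.1
    · simpa using h1.2 ⟨h4, h5⟩
    · simpa using h2.2 ⟨h4, h5⟩
  · rintro ⟨h4, h5⟩
    have h6 : (altGraph hB).dist p q ≠ 0 := fun h => h5 (h0.1 h)
    have h7 : (altGraph hB).dist p q ≠ 1 := fun h => (h1.1 h).1 h4
    have h8 : (altGraph hB).dist p q ≠ 2 := fun h => (h2.1 h).1 h4
    omega

/-- Together with `sub_eq_form_iff`, this shows that the distance from `0` to `(x, a)` records
whether `x = 0` and whether `a = 0`. -/
theorem fst_eq_iff [Nontrivial V] {p q : V × A} :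
    p.1 = q.1 ↔ (altGraph hB).dist p q = 0 ∨ (altGraph hB).dist p q = 3 := by
  rw [dist_eq_zero_iff, dist_eq_three_iff]
  by_cases h : p = q <;> simp [h]

theorem sub_eq_form_iff [Nontrivial V] {p q : V × A} :
    p.2 - q.2 = B p.1 q.1 ↔ (altGraph hB).dist p q = 0 ∨ (altGraph hB).dist p q = 1 := by
  rw [dist_eq_zero_iff, dist_eq_one_iff]
  constructor
  · intro h
    by_cases h' : p.1 = q.1
    · rw [h', hB.self, sub_eq_zero] at h
      exact Or.inl (Prod.ext h' h)
    · exact Or.inr ⟨h', h⟩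
  · rintro (rfl | h)
    · rw [hB.self, sub_self]
    · exact h.2

theorem ediam_eq_three [Nontrivial V] [Nontrivial A] : (altGraph hB).ediam = 3 := by
  refine le_antisymm (SimpleGraph.ediam_le_of_edist_le (edist_le_three hB)) ?_
  obtain ⟨a, ha⟩ := exists_ne (0 : A)
  have h : (altGraph hB).dist (0, 0) (0, a) = 3 :=
    (dist_eq_three_iff hB).2 ⟨rfl, fun h => ha (congrArg Prod.snd h).symm⟩
  have h' := ((connected hB).preconnected (0, 0) (0, a)).coe_dist_eq_edist
  rw [h] at h'
  exact h'.le.trans SimpleGraph.edist_le_ediam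

theorem diam_eq_three [Nontrivial V] [Nontrivial A] : (altGraph hB).diam = 3 := by
  rw [SimpleGraph.diam, ediam_eq_three]
  rfl

theorem isAntipodal [Nontrivial V] [Nontrivial A] : IsAntipodal (altGraph hB) := by
  refine ⟨connected hB, by simp [ediam_eq_three hB], (diam_eq_three hB).ge, fun x y z => ?_⟩
  rw [diam_eq_three, dist_eq_three_iff, dist_eq_three_iff, dist_eq_three_iff]
  exact fun h1 h2 h3 => ⟨h1.1.trans h2.1, h3⟩

/-! ### Intersection numbers -/

/-- The first coordinate of a neighbour of `q` determines it, so every intersection number becomes a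
count in `V`. -/
theorem ncard_adj_and (q : V × A) (P : V × A → Prop) :
    {z | (altGraph hB).Adj q z ∧ P z}.ncard
      = {w | w ≠ q.1 ∧ P (w, q.2 - B q.1 w)}.ncard := by
  have hinj : Function.Injective fun w => (w, q.2 - B q.1 w) :=
    fun w w' h => congrArg Prod.fst h
  rw [← Set.ncard_image_of_injective _ hinj]
  congr 1
  ext ⟨w, c⟩
  constructor
  · rintro ⟨⟨h1, h2⟩, h3⟩
    have h4 : q.2 - B q.1 w = c := by
      dsimp only at h2
      rw [← h2, sub_sub_cancel]
    exact ⟨w, ⟨h1.symm, by rwa [h4]⟩, Prod.ext rfl h4⟩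
  · rintro ⟨w', ⟨h1, h2⟩, h3⟩
    obtain ⟨rfl, rfl⟩ := Prod.mk.inj h3
    exact ⟨⟨h1.symm, by simp⟩, h2⟩

theorem isDistanceRegular [Finite V] [Nontrivial V] [Nontrivial A] {r : ℕ}
    (hr : r * Nat.card A = Nat.card V) :
    IsDistanceRegular (altGraph hB) [Nat.card V - 1, Nat.card V - r, 1]
      [1, r, Nat.card V - 1] where
  connected := connected hB
  length_eq := rfl
  diameter := ediam_eq_three hB
  card_up := by
    rintro ⟨x, a⟩ ⟨y, b⟩
    rw [ncard_adj_and]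
    have hle := dist_le_three hB (x, a) (y, b)
    obtain h | h | h | h : (altGraph hB).dist (x, a) (y, b) = 0 ∨
      (altGraph hB).dist (x, a) (y, b) = 1 ∨ (altGraph hB).dist (x, a) (y, b) = 2 ∨
      (altGraph hB).dist (x, a) (y, b) = 3 := by omega
    · rw [h]
      obtain ⟨rfl, rfl⟩ := Prod.mk.inj ((dist_eq_zero_iff hB).1 h)
      have : {w | w ≠ x ∧ (altGraph hB).dist (x, a) (w, a - B x w) = 0 + 1} = {x}ᶜ := by
        ext w
        simp only [zero_add, dist_eq_one_iff, Set.mem_ofPred_eq, Set.mem_compl_iff,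
          Set.mem_singleton_iff, sub_sub_cancel, and_true]
        exact ⟨fun h => h.1, fun h => ⟨h, Ne.symm h⟩⟩
      dsimp only
      rw [this, Set.ncard_compl, Set.ncard_singleton]
      rfl
    · rw [h]
      obtain ⟨h1, h2⟩ := (dist_eq_one_iff hB).1 h
      dsimp only at h1 h2
      -- The solutions of `B (x - y) w = B x y` are `x`, `y` and the first coordinates of the common
      -- neighbours. They form a fibre of size `r`, and the other `w` give the neighbours at
      -- distance two.
      have : {w | w ≠ y ∧ (altGraph hB).dist (x, a) (w, b - B y w) = 1 + 1}
          = {w | B (x - y) w = B x y}ᶜ := by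
        ext w
        simp only [Nat.reduceAdd, dist_eq_two_iff, Set.mem_ofPred_eq, Set.mem_compl_iff]
        have e : a - (b - B y w) = B x y + B y w := by rw [← h2]; abel
        rw [e, hB.sub_left]
        constructor
        · rintro ⟨_, _, h3⟩ h4
          exact h3 (by rw [← h4]; abel)
        · intro h3
          refine ⟨?_, ?_, ?_⟩
          · rintro rfl
            exact h3 (by rw [hB.self, sub_zero])
          · rintro rfl
            exact h3 (by rw [hB.self, zero_sub, hB.neg_swap, neg_neg])
          · intro h4
            exact h3 (by rw [← h4]; abel)
      dsimp only
      rw [this, Set.ncard_compl, hB.ncard_fibre hr (sub_ne_zero.2 h1)]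
      rfl
    · rw [h]
      obtain ⟨h1, h2⟩ := (dist_eq_two_iff hB).1 h
      dsimp only at h1 h2
      have : {w | w ≠ y ∧ (altGraph hB).dist (x, a) (w, b - B y w) = 2 + 1} = {x} := by
        ext w
        simp only [Nat.reduceAdd, dist_eq_three_iff, Set.mem_ofPred_eq, Set.mem_singleton_iff]
        constructor
        · exact fun h => h.2.1.symm
        · rintro rfl
          refine ⟨h1, rfl, fun h3 => h2 ?_⟩
          rw [(Prod.mk.inj h3).2, sub_sub_cancel_left, ← hB.neg_swap]
      dsimp only
      rw [this, Set.ncard_singleton]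
      rfl
    · rw [h]
      -- The index 3 lies beyond the list, and its default value 0 is the correct `b₃`.
      have : {w | w ≠ y ∧ (altGraph hB).dist (x, a) (w, b - B y w) = 3 + 1} = ∅ := by
        ext w
        have := dist_le_three hB (x, a) (w, b - B y w)
        simp only [Set.mem_ofPred_eq, Set.mem_empty_iff_false, iff_false]
        omega
      dsimp only
      rw [this, Set.ncard_empty]
      rfl
  card_down := by
    rintro ⟨x, a⟩ ⟨y, b⟩
    rw [ncard_adj_and]
    have hle := dist_le_three hB (x, a) (y, b)
    obtain h | h | h | h : (altGraph hB).dist (x, a) (y, b) = 0 ∨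
      (altGraph hB).dist (x, a) (y, b) = 1 ∨ (altGraph hB).dist (x, a) (y, b) = 2 ∨
      (altGraph hB).dist (x, a) (y, b) = 3 := by omega
    · rw [h]
      simp
    · rw [h]
      obtain ⟨h1, h2⟩ := (dist_eq_one_iff hB).1 h
      dsimp only at h1 h2
      have : {w | w ≠ y ∧ (altGraph hB).dist (x, a) (w, b - B y w) + 1 = 1} = {x} := by
        ext w
        simp only [Nat.add_eq_right, dist_eq_zero_iff, Set.mem_ofPred_eq, Set.mem_singleton_iff,
          Prod.mk.injEq]
        constructor
        · exact fun h => h.2.1.symm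
        · rintro rfl
          refine ⟨h1, rfl, ?_⟩
          rw [hB.neg_swap w y, ← h2]
          abel
      dsimp only
      rw [this, Set.ncard_singleton]
      rfl
    · rw [h]
      obtain ⟨h1, h2⟩ := (dist_eq_two_iff hB).1 h
      dsimp only at h1 h2
      -- This is the equation of `exists_adj_adj`, so `c₂` is the size `r` of a fibre.
      have : {w | w ≠ y ∧ (altGraph hB).dist (x, a) (w, b - B y w) + 1 = 2}
          = {w | B (x - y) w = a - b} := by
        ext w
        simp only [Nat.reduceEqDiff, dist_eq_one_iff, Set.mem_ofPred_eq]
        rw [hB.sub_left]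
        constructor
        · rintro ⟨_, _, h3⟩
          rw [← h3]
          abel
        · intro h3
          refine ⟨?_, ?_, ?_⟩
          · rintro rfl
            exact h2 (by rw [← h3, hB.self, sub_zero])
          · rintro rfl
            exact h2 (by rw [← h3, hB.self, zero_sub, hB.neg_swap, neg_neg])
          · rw [sub_eq_iff_eq_add.1 h3, sub_add]
      dsimp only
      rw [this, hB.ncard_fibre hr (sub_ne_zero.2 h1)]
      rfl
    · rw [h]
      obtain ⟨h1, h2⟩ := (dist_eq_three_iff hB).1 h
      dsimp only at h1
      subst h1
      have : {w | w ≠ x ∧ (altGraph hB).dist (x, a) (w, b - B x w) + 1 = 3} = {x}ᶜ := by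
        ext w
        simp only [Nat.reduceEqDiff, dist_eq_two_iff, Set.mem_ofPred_eq, Set.mem_compl_iff,
          Set.mem_singleton_iff]
        refine ⟨fun h => h.1, fun h => ⟨h, Ne.symm h, fun h3 => h2 ?_⟩⟩
        rw [← sub_eq_zero] at h3
        have h4 : a - b = 0 := by
          rw [← h3]
          abel
        rw [sub_eq_zero.1 h4]
      dsimp only
      rw [this, Set.ncard_compl, Set.ncard_singleton]
      rfl

/-- Translations act on the graph. -/
def translate (t : V × A) : altGraph hB ≃g altGraph hB where
  -- The term `B p.1 t.1` compensates for `B (x + t) (y + t) - B x y = B x t - B y t`.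
  toFun p := (p.1 + t.1, p.2 + (t.2 + B p.1 t.1))
  invFun p := (p.1 - t.1, p.2 - (t.2 + B (p.1 - t.1) t.1))
  left_inv p := by simp
  right_inv p := by simp
  map_rel_iff' {p q} := by
    obtain ⟨x, a⟩ := p
    obtain ⟨y, b⟩ := q
    obtain ⟨t, s⟩ := t
    change (x + t ≠ y + t ∧ a + (s + B x t) - (b + (s + B y t)) = B (x + t) (y + t)) ↔
      (x ≠ y ∧ a - b = B x y)
    have e : B (x + t) (y + t) = B x y + (B x t - B y t) := by
      rw [hB.add_left, hB.add_right, hB.add_right, hB.self, hB.neg_swap y t]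
      abel
    have e' : a + (s + B x t) - (b + (s + B y t)) = (a - b) + (B x t - B y t) := by abel
    rw [e, e', add_left_inj, ne_eq, add_left_inj]

theorem translate_zero (t : V × A) : translate hB t 0 = t := by
  change ((0 : V) + t.1, (0 : A) + (t.2 + B 0 t.1)) = t
  simp [hB.zero_left]

/-- Similitudes of the form act on the graph. -/
def similitude (L : V ≃+ V) (M : A ≃+ A) (h : ∀ x y, B (L x) (L y) = M (B x y)) :
    altGraph hB ≃g altGraph hB where
  toEquiv := L.toEquiv.prodCongr M.toEquiv
  map_rel_iff' {p q} := by
    change (L p.1 ≠ L q.1 ∧ M p.2 - M q.2 = B (L p.1) (L q.1)) ↔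
      (p.1 ≠ q.1 ∧ p.2 - q.2 = B p.1 q.1)
    rw [h, ← map_sub, M.injective.eq_iff, L.injective.ne_iff]

theorem similitude_apply (L : V ≃+ V) (M : A ≃+ A) (h : ∀ x y, B (L x) (L y) = M (B x y))
    (p : V × A) : similitude hB L M h p = (L p.1, M p.2) :=
  rfl

/-- Translations are transitive on vertices, so it suffices to move `(x, a)` to `(y, b)` while
fixing `0`. Equal distances from `0` mean that `x`, `y` vanish together and `a`, `b` vanish
together. A similitude first takes `a` to `b`; an isometry then corrects the first coordinate
without disturbing the second. -/
theorem isDistanceTransitive [Nontrivial V]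
    (hL : ∀ x y : V, x ≠ 0 → y ≠ 0 → ∃ L : V ≃+ V, (∀ v w, B (L v) (L w) = B v w) ∧ L x = y)
    (hM : ∀ a b : A, a ≠ 0 → b ≠ 0 → ∃ (L : V ≃+ V) (M : A ≃+ A),
      (∀ v w, B (L v) (L w) = M (B v w)) ∧ M a = b) :
    IsDistanceTransitive (altGraph hB) := by
  refine ⟨connected hB, ?_⟩
  have key : ∀ q q' : V × A, (altGraph hB).dist 0 q = (altGraph hB).dist 0 q' →
      ∃ φ : altGraph hB ≃g altGraph hB, φ 0 = 0 ∧ φ q = q' := by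
    rintro ⟨x, a⟩ ⟨y, b⟩ h
    have hx : x = 0 ↔ y = 0 := by
      have e := fst_eq_iff hB (p := 0) (q := (x, a))
      rw [h, ← fst_eq_iff hB] at e
      exact eq_comm.trans (e.trans eq_comm)
    have ha : a = 0 ↔ b = 0 := by
      have e := sub_eq_form_iff hB (p := 0) (q := (x, a))
      rw [h, ← sub_eq_form_iff hB] at e
      simpa only [Prod.fst_zero, Prod.snd_zero, hB.zero_left, zero_sub, neg_eq_zero] using e
    obtain ⟨L₁, M, hLM, hab⟩ : ∃ (L : V ≃+ V) (M : A ≃+ A),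
        (∀ v w, B (L v) (L w) = M (B v w)) ∧ M a = b := by
      by_cases h : a = 0
      · exact ⟨.refl V, .refl A, fun _ _ => rfl, by rw [h, ha.1 h]; rfl⟩
      · exact hM a b h (fun h' => h (ha.2 h'))
    obtain ⟨L₂, hL₂, hxy⟩ : ∃ L : V ≃+ V, (∀ v w, B (L v) (L w) = B v w) ∧ L (L₁ x) = y := by
      by_cases h : x = 0
      · exact ⟨.refl V, fun _ _ => rfl, by rw [h, hx.1 h, map_zero, map_zero]⟩
      · exact hL _ _ ((map_ne_zero_iff _ L₁.injective).2 h) (fun h' => h (hx.2 h'))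
    refine ⟨similitude hB (L₁.trans L₂) M fun v w => ?_, ?_, ?_⟩
    · rw [AddEquiv.trans_apply, AddEquiv.trans_apply, hL₂, hLM]
    · rw [similitude_apply]
      simp
    · rw [similitude_apply]
      simp [hxy, hab]
  intro x y x' y' h
  have e := dist_iso (translate hB x).symm x y
  have e' := dist_iso (translate hB x').symm x' y'
  have hx : (translate hB x).symm x = 0 := by
    rw [RelIso.symm_apply_eq, translate_zero]
  have hx' : (translate hB x').symm x' = 0 := by
    rw [RelIso.symm_apply_eq, translate_zero]
  rw [hx] at e
  rw [hx'] at e'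
  obtain ⟨φ, h1, h2⟩ := key _ _ (e.trans (h.trans e'.symm))
  refine ⟨((translate hB x).symm.trans φ).trans (translate hB x'), ?_, ?_⟩
  · rw [RelIso.trans_apply, RelIso.trans_apply, hx, h1, translate_zero]
  · rw [RelIso.trans_apply, RelIso.trans_apply, h2, RelIso.apply_symm_apply]

/-- A surjection of the value groups induces a covering. -/
theorem isGraphCovering {A' : Type*} [AddCommGroup A'] [Finite A] {B' : V → V → A'}
    (hB' : IsNondegAlternating B') (π : A →+ A') (hπ : Function.Surjective π)
    (h : ∀ x y, π (B x y) = B' x y) {r : ℕ} (hr : r * Nat.card A' = Nat.card A) :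
    IsGraphCovering (altGraph hB) (altGraph hB') (Prod.map id π) r where
  surjective := Function.surjective_id.prodMap hπ
  bijOn := by
    rintro ⟨x, a⟩
    refine ⟨?_, ?_, ?_⟩
    · rintro ⟨y, b⟩ ⟨h1, h2⟩
      refine ⟨h1, ?_⟩
      change π a - π b = B' x y
      rw [← map_sub, ← h]
      exact congrArg π h2
    · rintro ⟨y, b⟩ ⟨h1, h2⟩ ⟨z, c⟩ ⟨h3, h4⟩ h5
      obtain rfl : y = z := congrArg Prod.fst h5
      exact Prod.ext rfl (sub_right_injective (h2.trans h4.symm))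
    · rintro ⟨y, b⟩ ⟨h1, h2⟩
      refine ⟨(y, a - B x y), ⟨h1, sub_sub_cancel _ _⟩, Prod.ext rfl ?_⟩
      change π a - b = B' x y at h2
      change π (a - B x y) = b
      rw [map_sub, h, ← h2, sub_sub_cancel]
  card_fibre := by
    have : Finite A' := Finite.of_surjective π hπ
    rintro ⟨x, a'⟩
    obtain ⟨a₀, rfl⟩ := hπ a'
    have hs : Prod.map id π ⁻¹' {(x, π a₀)} = (fun k => (x, a₀ + k)) '' (π.ker : Set A) := by
      ext ⟨y, b⟩
      simp only [Set.mem_preimage, Prod.map_apply, id_eq, Set.mem_singleton_iff, Prod.mk.injEq,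
        Set.mem_image, SetLike.mem_coe, AddMonoidHom.mem_ker]
      constructor
      · rintro ⟨rfl, hb⟩
        exact ⟨b - a₀, by rw [map_sub, hb, sub_self], rfl, add_sub_cancel _ _⟩
      · rintro ⟨k, hk, rfl, rfl⟩
        exact ⟨rfl, by rw [map_add, hk, add_zero]⟩
    have hinj : Function.Injective fun k => (x, a₀ + k) :=
      fun k k' hk => add_right_injective a₀ (congrArg Prod.snd hk)
    rw [hs]
    refine ⟨(Set.toFinite _).image _, ?_⟩
    rw [Set.ncard_image_of_injective _ hinj]
    have h1 : Nat.card A = Nat.card A' * Nat.card π.ker := by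
      rw [AddSubgroup.card_eq_card_quotient_mul_card_addSubgroup π.ker,
        Nat.card_congr (QuotientAddGroup.quotientKerEquivOfSurjective π hπ).toEquiv]
    rw [← hr, mul_comm] at h1
    exact (Nat.eq_of_mul_eq_mul_left Nat.card_pos h1).symm

/-- The fibres of the projection to `V` are the antipodal classes. -/
theorem proj_eq_iff [Nontrivial V] {A' X Y : Type*} [Subsingleton A'] {π : A → A'}
    {G : SimpleGraph X} (φ : G ≃g altGraph hB) {g : Y → V × A'} (hg : Function.Injective g)
    {f : X → Y} (hf : ∀ x, g (f x) = Prod.map id π (φ x)) (x y : X) :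
    f x = f y ↔ x = y ∨ G.dist x y = 3 := by
  have h : f x = f y ↔ (φ x).1 = (φ y).1 := by
    rw [← hg.eq_iff, hf, hf, Prod.ext_iff]
    exact and_iff_left (Subsingleton.elim _ _)
  rw [h, fst_eq_iff hB, dist_eq_zero_iff, dist_iso, φ.injective.eq_iff]

end altGraph

end AltGraph

/-! ### The determinant form on `K × K` -/

section DetForm

variable {K : Type*} [Field K]

theorem exists_det_eq {p : K × K} (hp : p ≠ 0) (c : K) :
    ∃ q : K × K, p.1 * q.2 - p.2 * q.1 = c := by
  by_cases h : p.1 = 0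
  · have h2 : p.2 ≠ 0 := fun h2 => hp (Prod.ext h h2)
    exact ⟨(-(c / p.2), 0), by field_simp; simp⟩
  · exact ⟨(0, c / p.1), by field_simp; simp⟩

/-- The special linear group is transitive on nonzero vectors. -/
theorem exists_det_isometry_one (y : K × K) (hy : y ≠ 0) :
    ∃ L : (K × K) ≃+ (K × K),
      (∀ v w, (L v).1 * (L w).2 - (L v).2 * (L w).1 = v.1 * w.2 - v.2 * w.1) ∧ L (1, 0) = y := by
  -- The vectors `y` and `z` are the columns of a matrix of determinant one; the inverse below is
  -- its adjugate.
  obtain ⟨z, hz⟩ := exists_det_eq hy 1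
  refine ⟨{ toFun := fun v => (v.1 * y.1 + v.2 * z.1, v.1 * y.2 + v.2 * z.2)
            invFun := fun w => (w.1 * z.2 - w.2 * z.1, y.1 * w.2 - y.2 * w.1)
            left_inv := fun v => ?_
            right_inv := fun w => ?_
            map_add' := fun v w => ?_ }, fun v w => ?_, ?_⟩
  · ext
    · linear_combination v.1 * hz
    · linear_combination v.2 * hz
  · ext
    · linear_combination w.1 * hz
    · linear_combination w.2 * hz
  · ext
    · simp only [Prod.fst_add, Prod.snd_add]; ring
    · simp only [Prod.fst_add, Prod.snd_add]; ring
  · change (v.1 * y.1 + v.2 * z.1) * (w.1 * y.2 + w.2 * z.2)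
      - (v.1 * y.2 + v.2 * z.2) * (w.1 * y.1 + w.2 * z.1) = _
    linear_combination (v.1 * w.2 - v.2 * w.1) * hz
  · simp

theorem exists_det_isometry (x y : K × K) (hx : x ≠ 0) (hy : y ≠ 0) :
    ∃ L : (K × K) ≃+ (K × K),
      (∀ v w, (L v).1 * (L w).2 - (L v).2 * (L w).1 = v.1 * w.2 - v.2 * w.1) ∧ L x = y := by
  obtain ⟨L₁, h1, e1⟩ := exists_det_isometry_one x hx
  obtain ⟨L₂, h2, e2⟩ := exists_det_isometry_one y hy
  refine ⟨L₁.symm.trans L₂, fun v w => ?_, ?_⟩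
  · have := h1 (L₁.symm v) (L₁.symm w)
    rw [L₁.apply_symm_apply, L₁.apply_symm_apply] at this
    rw [AddEquiv.trans_apply, AddEquiv.trans_apply, h2, this]
  · rw [AddEquiv.trans_apply, ← e1, L₁.symm_apply_apply, e2]

variable [Algebra (ZMod 2) K]

/-- The determinant of two vectors of `K × K`, modulo a subspace `W` of `K`. -/
def detForm (W : Submodule (ZMod 2) K) (p q : K × K) : K ⧸ W :=
  W.mkQ (p.1 * q.2 - p.2 * q.1)

theorem isNondegAlternating_detForm (W : Submodule (ZMod 2) K) :
    IsNondegAlternating (detForm W) where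
  add_left x y z := by
    rw [detForm, detForm, detForm, ← map_add]
    congr 1
    simp only [Prod.fst_add, Prod.snd_add]
    ring
  add_right x y z := by
    rw [detForm, detForm, detForm, ← map_add]
    congr 1
    simp only [Prod.fst_add, Prod.snd_add]
    ring
  self x := by rw [detForm, mul_comm, sub_self, map_zero]
  surj x hx a := by
    obtain ⟨c, rfl⟩ := W.mkQ_surjective a
    obtain ⟨q, rfl⟩ := exists_det_eq hx c
    exact ⟨q, rfl⟩

/-- It suffices for distance-transitivity that the similitudes act transitively on the nonzero
elements of `K ⧸ W`. -/
theorem isDistanceTransitive_detForm (W : Submodule (ZMod 2) K)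
    (hM : ∀ a b : K ⧸ W, a ≠ 0 → b ≠ 0 →
      ∃ (L : (K × K) ≃+ (K × K)) (M : (K ⧸ W) ≃+ (K ⧸ W)),
        (∀ v w, detForm W (L v) (L w) = M (detForm W v w)) ∧ M a = b) :
    IsDistanceTransitive (altGraph (isNondegAlternating_detForm W)) := by
  refine altGraph.isDistanceTransitive _ (fun x y hx hy => ?_) hM
  obtain ⟨L, h1, h2⟩ := exists_det_isometry x y hx hy
  exact ⟨L, fun v w => by rw [detForm, detForm, h1], h2⟩

/-- There is at most one nonzero value, so the identity already serves as the similitude. -/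
theorem isDistanceTransitive_detForm_of_card_le_two [Finite K] (W : Submodule (ZMod 2) K)
    (hW : Nat.card (K ⧸ W) ≤ 2) :
    IsDistanceTransitive (altGraph (isNondegAlternating_detForm W)) := by
  refine isDistanceTransitive_detForm W fun a b ha hb => ?_
  refine ⟨.refl _, .refl _, fun _ _ => rfl, ?_⟩
  change a = b
  by_contra hab
  have : Finite (K ⧸ W) := Finite.of_surjective _ W.mkQ_surjective
  have h3 : ({0, a, b} : Set (K ⧸ W)).ncard = 3 :=
    Set.ncard_eq_three.2 ⟨0, a, b, ha.symm, hb.symm, hab, rfl⟩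
  have := Set.ncard_le_card ({0, a, b} : Set (K ⧸ W))
  omega

/-- Scaling the first coordinate by `b / a` multiplies determinants by `b / a`. -/
theorem isDistanceTransitive_detForm_bot :
    IsDistanceTransitive (altGraph (isNondegAlternating_detForm (⊥ : Submodule (ZMod 2) K))) := by
  refine isDistanceTransitive_detForm ⊥ fun a b ha hb => ?_
  obtain ⟨a, rfl⟩ := Submodule.mkQ_surjective _ a
  obtain ⟨b, rfl⟩ := Submodule.mkQ_surjective _ b
  have ha' : a ≠ 0 := by rintro rfl; simp at ha
  have hb' : b ≠ 0 := by rintro rfl; simp at hb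
  have hc : b / a ≠ 0 := div_ne_zero hb' ha'
  let m : K ≃ₗ[ZMod 2] K :=
    { AddAut.mulLeft (Units.mk0 _ hc) with
      map_smul' := ZMod.map_smul (AddAut.mulLeft (Units.mk0 _ hc)).toAddMonoidHom }
  have hm : ∀ x, m x = b / a * x := fun x => rfl
  refine ⟨m.toAddEquiv.prodCongr (.refl K),
    (Submodule.Quotient.equiv ⊥ ⊥ m (Submodule.map_bot _)).toAddEquiv, fun v w => ?_, ?_⟩
  · change Submodule.Quotient.mk _ = Submodule.Quotient.mk (m _)
    congr 1
    change m v.1 * w.2 - v.2 * m w.1 = m _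
    rw [hm, hm, hm]
    ring
  · change Submodule.Quotient.mk (m _) = Submodule.Quotient.mk _
    congr 1
    rw [hm, div_mul_cancel₀ _ ha']

/-- Let `W = {0, w}`. The semilinear map `(v₁, v₂) ↦ (w⁻¹ v₁², v₂²)` changes a determinant `d` into
`w⁻¹ d²`. The map `x ↦ w⁻¹ x²` fixes `w`, hence acts on the four elements of `K ⧸ W`. There its cube
is the identity and it has no nonzero fixed point, so it permutes the three nonzero elements
cyclically. -/
theorem isDistanceTransitive_detForm_of_card_eight [Fintype K] (hK : Fintype.card K = 8)
    (W : Submodule (ZMod 2) K) (hW : Nat.card W = 2) :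
    IsDistanceTransitive (altGraph (isNondegAlternating_detForm W)) := by
  have : CharP K 2 := charP_of_injective_algebraMap (algebraMap (ZMod 2) K).injective 2
  obtain ⟨w, hw0, hw⟩ : ∃ w : K, w ≠ 0 ∧ ∀ x, x ∈ W ↔ x = 0 ∨ x = w := by
    obtain ⟨a, b, hab, h⟩ := Nat.card_eq_two_iff.1 hW
    have key : ∃ w : W, w ≠ 0 ∧ ∀ x : W, x = 0 ∨ x = w := by
      have h' : ∀ x : W, x = a ∨ x = b := fun x => by
        have : x ∈ ({a, b} : Set W) := h ▸ Set.mem_univ x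
        simpa using this
      rcases h' 0 with h0 | h0
      · exact ⟨b, by rw [h0]; exact hab.symm, by rw [h0]; exact h'⟩
      · exact ⟨a, by rw [h0]; exact hab, by rw [h0]; exact fun x => (h' x).symm⟩
    obtain ⟨w, hw0, hw⟩ := key
    refine ⟨w, fun h => hw0 (Subtype.ext h), fun x => ⟨fun hx => ?_, ?_⟩⟩
    · exact (hw ⟨x, hx⟩).imp (congrArg Subtype.val) (congrArg Subtype.val)
    · rintro (rfl | rfl)
      exacts [W.zero_mem, w.2]
  let sq : K ≃+ K := (frobeniusEquiv K 2).toAddEquiv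
  have hsq : ∀ x, sq x = x ^ 2 := fun x => rfl
  let m : K ≃ₗ[ZMod 2] K :=
    { sq.trans (AddAut.mulLeft (Units.mk0 _ (inv_ne_zero hw0))) with
      map_smul' := ZMod.map_smul
        (sq.trans (AddAut.mulLeft (Units.mk0 _ (inv_ne_zero hw0)))).toAddMonoidHom }
  have hm : ∀ x, m x = w⁻¹ * x ^ 2 := fun x => rfl
  have hmW : W.map (m : K →ₗ[ZMod 2] K) = W := by
    ext x
    simp only [Submodule.mem_map, hw]
    constructor
    · rintro ⟨y, rfl | rfl, rfl⟩
      · simp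
      · right
        change m y = y
        rw [hm]
        field_simp
    · rintro (rfl | rfl)
      · exact ⟨0, Or.inl rfl, by simp⟩
      · refine ⟨x, Or.inr rfl, ?_⟩
        change m x = x
        rw [hm]
        field_simp
  let M : (K ⧸ W) ≃+ (K ⧸ W) := (Submodule.Quotient.equiv W W m hmW).toAddEquiv
  have hM : ∀ x : K, M (W.mkQ x) = W.mkQ (m x) := fun x => rfl
  let L : (K × K) ≃+ (K × K) := m.toAddEquiv.prodCongr sq
  have hLM : ∀ v w, detForm W (L v) (L w) = M (detForm W v w) := fun v z => by
    rw [detForm, detForm, hM]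
    congr 1
    change m v.1 * sq z.2 - sq v.2 * m z.1 = _
    rw [hm, hm, hm, hsq, hsq, sub_pow_char]
    ring
  have h8 : ∀ s : K, s ^ 8 = s := fun s => by rw [← hK]; exact FiniteField.pow_card s
  have hM3 : ∀ a, M (M (M a)) = a := fun a => by
    obtain ⟨t, rfl⟩ := W.mkQ_surjective a
    rw [hM, hM, hM, hm, hm, hm]
    congr 1
    -- Both sides are `w⁻⁷ t⁸`.
    calc w⁻¹ * (w⁻¹ * (w⁻¹ * t ^ 2) ^ 2) ^ 2 = w * (w⁻¹ * t) ^ 8 := by field_simp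
      _ = t := by rw [h8]; field_simp
  have hfix : ∀ a, a ≠ 0 → M a ≠ a := fun a ha hfix => by
    obtain ⟨t, rfl⟩ := W.mkQ_surjective a
    obtain ⟨s, rfl⟩ : ∃ s, t = w * s := ⟨w⁻¹ * t, by field_simp⟩
    rw [hM, ← sub_eq_zero, ← map_sub, Submodule.mkQ_apply, Submodule.Quotient.mk_eq_zero, hw,
      hm] at hfix
    have e : w⁻¹ * (w * s) ^ 2 - w * s = w * (s ^ 2 - s) := by field_simp
    rw [e] at hfix
    rcases hfix with h | h
    · have h' : s * (s - 1) = 0 := by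
        rcases mul_eq_zero.1 h with h | h
        · exact absurd h hw0
        · linear_combination h
      apply ha
      rw [Submodule.mkQ_apply, Submodule.Quotient.mk_eq_zero, hw]
      rcases mul_eq_zero.1 h' with h | h
      · exact Or.inl (by rw [h, mul_zero])
      · exact Or.inr (by rw [sub_eq_zero.1 h, mul_one])
    -- Such an `s` would generate a subfield of order four: `s⁴ = s` and `s⁸ = s` force `s² = s`, a
    -- contradiction.
    · have h1 : s ^ 2 = s + 1 := by
        have := mul_left_cancel₀ hw0 (h.trans (mul_one w).symm)
        linear_combination this
      have h2 : (2 : K) = 0 := CharTwo.two_eq_zero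
      have h4 : s ^ 4 = s := by
        linear_combination (s ^ 2 + s + 2) * h1 + (s + 1) * h2
      have h9 : s ^ 2 = s := by
        linear_combination h8 s - (s ^ 4 + s) * h4
      rw [h1] at h9
      exact one_ne_zero (add_eq_left.1 h9)
  have hcard : Nat.card (K ⧸ W) = 4 := by
    have := W.card_eq_card_quotient_mul_card
    rw [hW, Nat.card_eq_fintype_card, hK] at this
    omega
  refine isDistanceTransitive_detForm W fun a b ha hb => ?_
  have h0 : M a ≠ 0 := (map_ne_zero_iff _ M.injective).2 ha
  have h0' : M (M a) ≠ 0 := (map_ne_zero_iff _ M.injective).2 h0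
  have h1 := hfix a ha
  have h2 := hfix _ h0
  have h3 : M (M a) ≠ a := fun h => hfix _ h0' (by rw [hM3, h])
  have hb' : b = a ∨ b = M a ∨ b = M (M a) := by
    classical
    have : Finite (K ⧸ W) := Finite.of_surjective _ W.mkQ_surjective
    have : Fintype (K ⧸ W) := Fintype.ofFinite _
    have hu : ({0, a, M a, M (M a)} : Finset (K ⧸ W)) = Finset.univ := by
      rw [← Finset.card_eq_iff_eq_univ, ← Nat.card_eq_fintype_card, hcard,
        Finset.card_insert_of_notMem, Finset.card_insert_of_notMem, Finset.card_pair h2.symm]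
      · simp [h1.symm, h3.symm]
      · simp [ha.symm, h0.symm, h0'.symm]
    have := Finset.mem_univ b
    rw [← hu] at this
    simpa [hb] using this
  rcases hb' with rfl | rfl | rfl
  · exact ⟨.refl _, .refl _, fun _ _ => rfl, rfl⟩
  · exact ⟨L, M, hLM, rfl⟩
  · refine ⟨L.trans L, M.trans M, fun v z => ?_, rfl⟩
    rw [AddEquiv.trans_apply, AddEquiv.trans_apply, AddEquiv.trans_apply, hLM, hLM]

end DetForm

/-! ### Binary words -/

section Words

variable {ι : Type*} [Fintype ι]

theorem zmod_two_eq_one {a : ZMod 2} (h : a ≠ 0) : a = 1 := by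
  revert a
  decide

theorem add_self_eq_zero_of_zmod_two {M : Type*} [AddCommGroup M] [Module (ZMod 2) M] (x : M) :
    x + x = 0 := by
  rw [← two_smul (ZMod 2) x, show (2 : ZMod 2) = 0 from rfl, zero_smul]

theorem sub_eq_add_of_zmod_two {M : Type*} [AddCommGroup M] [Module (ZMod 2) M] (x y : M) :
    x - y = x + y := by
  rw [sub_eq_iff_eq_add, add_assoc, add_self_eq_zero_of_zmod_two, add_zero]

theorem hammingNorm_add_le (x y : ι → ZMod 2) :
    hammingNorm (x + y) ≤ hammingNorm x + hammingNorm y := by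
  have h := hammingDist_triangle x 0 y
  rw [hammingDist_eq_hammingNorm x y, neg_add_eq_sub, sub_eq_add_of_zmod_two, add_comm y,
    hammingDist_zero_right, hammingDist_zero_left] at h
  exact h

theorem hammingDist_eq_one_iff [DecidableEq ι] (x y : ι → ZMod 2) :
    hammingDist x y = 1 ↔ ∃ i, x - y = Pi.single i 1 := by
  rw [hammingDist, Finset.card_eq_one]
  refine exists_congr fun i => ?_
  constructor
  · intro h
    ext j
    have hj : x j ≠ y j ↔ j = i := by
      rw [← Finset.mem_singleton, ← h]
      simp
    by_cases hji : j = i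
    · subst hji
      rw [Pi.single_eq_same]
      exact zmod_two_eq_one (sub_ne_zero.2 (hj.2 rfl))
    · rw [Pi.single_eq_of_ne hji, Pi.sub_apply, sub_eq_zero]
      exact not_not.1 (mt hj.1 hji)
  · intro h
    ext j
    rw [Finset.mem_filter_univ, Finset.mem_singleton, ← sub_ne_zero, ← Pi.sub_apply, h]
    by_cases hji : j = i
    · subst hji
      simp
    · simp [hji]

end Words

/-! ### Words of small weight over a field -/

section SmallWords

variable {F : Type*} [Field F] [Fintype F]

/-- The coordinates with respect to `1, α` as an additive equivalence. -/
theorem exists_coords_addEquiv {K : Type*} [Field K] [Fintype K] [Algebra K F] {u : ℕ} (hu : 1 ≤ u)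
    (hK : Fintype.card K = 2 ^ u) (hF : Fintype.card F = 2 ^ (2 * u))
    (α : Fˣ) (hα : ∀ x : Fˣ, x ∈ Subgroup.zpowers α) :
    ∃ e : F ≃+ K × K, ∀ x, coords K (α : F) x = e x := by
  let g : K × K ≃+ F :=
    { toFun := fun p => algebraMap K F p.1 + algebraMap K F p.2 * (α : F)
      invFun := coords K (α : F)
      left_inv := fun p => (coords_eq_iff K hu hK hF α hα _ p).2 rfl
      right_inv := fun x => ((coords_eq_iff K hu hK hF α hα x _).1 rfl).symm
      map_add' := fun p q => by
        simp only [Prod.fst_add, Prod.snd_add, map_add]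
        ring }
  exact ⟨g.symm, fun x => rfl⟩

variable [DecidableEq F]

/-- Otherwise the order of `α` would divide `2 ^ u - 1`. This makes the coefficient `α + α ^ 2 ^ u`
of `S` in the second syndrome nonzero. -/
theorem pow_two_pow_ne_self {u : ℕ} (hu : 1 ≤ u)
    (hF : Fintype.card F = 2 ^ (2 * u))
    (α : Fˣ) (hα : ∀ x : Fˣ, x ∈ Subgroup.zpowers α) : (α : F) ^ 2 ^ u ≠ α := by
  intro h
  have h3 : orderOf α = 2 ^ (2 * u) - 1 := by
    rw [orderOf_eq_card_of_forall_mem_zpowers hα, Nat.card_eq_fintype_card,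
      Fintype.card_units, hF]
  have hlt : 2 ^ u < 2 ^ (2 * u) := Nat.pow_lt_pow_right (by norm_num) (by omega)
  have h2u : 2 ^ 1 ≤ 2 ^ u := Nat.pow_le_pow_right (by norm_num) hu
  have h1 : α ^ (2 ^ u - 1) = 1 := by
    have h' : α ^ (2 ^ u - 1) * α = 1 * α := by
      rw [← pow_succ, Nat.sub_add_cancel (by omega), one_mul]
      exact Units.ext (by simpa using h)
    exact mul_right_cancel h'
  have h4 := Nat.le_of_dvd (by omega) (orderOf_dvd_of_pow_eq_one h1)
  omega

/-- The word with a single one at the position `x`, or zero if `x = 0`. -/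
def pointWord (x : F) : Word F :=
  if h : x = 0 then 0 else Pi.single (Units.mk0 x h) 1

theorem hammingNorm_pointWord_le (x : F) : hammingNorm (pointWord x) ≤ 1 := by
  rw [pointWord]
  split_ifs with h
  · simp
  · rw [← hammingDist_zero_right, ((hammingDist_eq_one_iff _ _).2 ⟨_, sub_zero _⟩)]

variable {K : Type*} [Field K] {e : F ≃+ K × K}

/-- A word of weight three with vanishing first syndrome, and with `S` prescribed. -/
def tripleWord (e : F ≃+ K × K) (b : K) : Word F :=
  pointWord (e.symm (1, 0)) + pointWord (e.symm (0, b)) + pointWord (e.symm (1, b))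

theorem hammingNorm_tripleWord_le (b : K) : hammingNorm (tripleWord e b) ≤ 3 := by
  refine (hammingNorm_add_le _ _).trans (add_le_add ((hammingNorm_add_le _ _).trans
    (add_le_add (hammingNorm_pointWord_le _) (hammingNorm_pointWord_le _)))
    (hammingNorm_pointWord_le _))

theorem quadS_single [Algebra K F] [Algebra (ZMod 2) K] {α : F}
    (he : ∀ x, coords K α x = e x) (x : Fˣ) :
    quadS K α (Pi.single x 1) = (e x).1 * (e x).2 := by
  rw [quadS, Fintype.linearCombination_apply_single, one_smul, he]

theorem quadS_pointWord [Algebra K F] [Algebra (ZMod 2) K] {α : F}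
    (he : ∀ x, coords K α x = e x) (x : F) :
    quadS K α (pointWord x) = (e x).1 * (e x).2 := by
  rw [pointWord]
  split_ifs with h
  · rw [h, map_zero, map_zero, Prod.fst_zero, zero_mul]
  · rw [quadS_single he, Units.val_mk0]

theorem quadS_tripleWord [Algebra K F] [Algebra (ZMod 2) K] {α : F}
    (he : ∀ x, coords K α x = e x) (b : K) :
    quadS K α (tripleWord e b) = b := by
  rw [tripleWord, map_add, map_add, quadS_pointWord he, quadS_pointWord he, quadS_pointWord he]
  simp

end SmallWords

/-! ### Syndromes -/

section Syndromes

variable {F : Type*} [Field F] [Fintype F] [DecidableEq F] [Algebra (ZMod 2) F]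

theorem syndromeH_single (x : Fˣ) : syndromeH F (Pi.single x 1) = (x : F) := by
  rw [syndromeH, Fintype.linearCombination_apply_single, one_smul]

theorem syndromeH_eq_sum (w : Word F) :
    syndromeH F w = ∑ x with w x ≠ 0, (x : F) := by
  rw [syndromeH, Fintype.linearCombination_apply, Finset.sum_filter]
  refine Finset.sum_congr rfl fun x _ => ?_
  split_ifs with h
  · rw [zmod_two_eq_one h, one_smul]
  · rw [not_not.1 h, zero_smul]

/-- The code `ker (syndromeH F)` has minimum distance at least three. -/
theorem eq_zero_of_syndromeH_eq_zero {w : Word F} (h : syndromeH F w = 0)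
    (hw : hammingNorm w ≤ 2) : w = 0 := by
  by_contra h0
  have h1 : hammingNorm w ≠ 0 := hammingNorm_ne_zero_iff.2 h0
  rw [syndromeH_eq_sum] at h
  rw [hammingNorm] at hw h1
  generalize (Finset.univ.filter fun x => w x ≠ 0) = s at *
  obtain h2 | h2 : s.card = 1 ∨ s.card = 2 := by omega
  · obtain ⟨x, rfl⟩ := Finset.card_eq_one.1 h2
    rw [Finset.sum_singleton] at h
    exact x.ne_zero h
  · obtain ⟨x, y, hxy, rfl⟩ := Finset.card_eq_two.1 h2
    rw [Finset.sum_pair hxy, ← sub_eq_add_of_zmod_two, sub_eq_zero] at h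
    exact hxy (Units.ext h)

theorem syndromeH_pointWord (x : F) : syndromeH F (pointWord x) = x := by
  rw [pointWord]
  split_ifs with h
  · rw [map_zero, h]
  · rw [syndromeH_single, Units.val_mk0]

variable {K : Type*} [Field K] {e : F ≃+ K × K}

theorem syndromeH_tripleWord (b : K) : syndromeH F (tripleWord e b) = 0 := by
  have h : ((1, b) : K × K) = (1, 0) + (0, b) := by simp
  rw [tripleWord, map_add, map_add, syndromeH_pointWord, syndromeH_pointWord,
    syndromeH_pointWord, ← map_add, ← h, add_self_eq_zero_of_zmod_two]

variable [Algebra K F] [Algebra (ZMod 2) K] {α : F}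

/-- The second syndrome is determined by the first one and by `S`. -/
theorem syndromeE_eq [Fintype K] {u : ℕ} (hu : 1 ≤ u)
    (hK : Fintype.card K = 2 ^ u) (hF : Fintype.card F = 2 ^ (2 * u))
    (α : Fˣ) (hα : ∀ x : Fˣ, x ∈ Subgroup.zpowers α)
    (he : ∀ x, coords K (α : F) x = e x) (w : Word F) :
    syndromeE F u w = algebraMap K F ((e (syndromeH F w)).1 ^ 2)
      + ((α : F) + (α : F) ^ 2 ^ u) * algebraMap K F (quadS K (α : F) w)
      + (α : F) ^ (2 ^ u + 1) * algebraMap K F ((e (syndromeH F w)).2 ^ 2) := by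
  have hK2 : CharP K 2 := charP_of_injective_algebraMap (algebraMap (ZMod 2) K).injective 2
  have hF2 : CharP F 2 := charP_of_injective_algebraMap (algebraMap (ZMod 2) F).injective 2
  -- The square terms of the norm are additive in `x`, so they depend only on the first syndrome.
  -- The cross term sums to a multiple of `S`, and the identity need only be checked on words of
  -- weight one.
  let g : F →+ F := AddMonoidHom.mk' (fun x => algebraMap K F ((e x).1 ^ 2)
      + (α : F) ^ (2 ^ u + 1) * algebraMap K F ((e x).2 ^ 2)) fun x y => by
    simp only [map_add, Prod.fst_add, Prod.snd_add, add_pow_char]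
    ring
  let T : K →+ F := AddMonoidHom.mk'
    (fun a => ((α : F) + (α : F) ^ 2 ^ u) * algebraMap K F a) fun x y => by
    rw [map_add, mul_add]
  have h1 : syndromeE F u = (g.toZModLinearMap 2) ∘ₗ syndromeH F
      + (T.toZModLinearMap 2) ∘ₗ quadS K (α : F) := by
    refine LinearMap.pi_ext' fun x => LinearMap.ext_ring ?_
    simp only [LinearMap.comp_apply, LinearMap.add_apply, LinearMap.coe_single]
    rw [syndromeE, Fintype.linearCombination_apply_single, one_smul, syndromeH_single,
      quadS_single he]
    change (x : F) ^ (2 ^ u + 1) = algebraMap K F ((e x).1 ^ 2)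
      + (α : F) ^ (2 ^ u + 1) * algebraMap K F ((e x).2 ^ 2)
      + ((α : F) + (α : F) ^ 2 ^ u) * algebraMap K F ((e x).1 * (e x).2)
    have hx := (coords_eq_iff K hu hK hF α hα x (e x)).1 (he x)
    have hp : ∀ a : K, (algebraMap K F a) ^ 2 ^ u = algebraMap K F a := fun a => by
      rw [← map_pow, ← hK, FiniteField.pow_card]
    generalize e (x : F) = p at hx ⊢
    rw [hx, pow_succ, add_pow_char_pow, mul_pow, hp, hp]
    simp only [map_pow, map_mul]
    ring
  rw [h1]
  change algebraMap K F ((e (syndromeH F w)).1 ^ 2)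
      + (α : F) ^ (2 ^ u + 1) * algebraMap K F ((e (syndromeH F w)).2 ^ 2)
      + ((α : F) + (α : F) ^ 2 ^ u) * algebraMap K F (quadS K (α : F) w) = _
  ring

theorem mem_baseCode_iff [Fintype K] {u : ℕ} (hu : 1 ≤ u)
    (hK : Fintype.card K = 2 ^ u) (hF : Fintype.card F = 2 ^ (2 * u))
    (α : Fˣ) (hα : ∀ x : Fˣ, x ∈ Subgroup.zpowers α)
    (he : ∀ x, coords K (α : F) x = e x) (w : Word F) :
    w ∈ baseCode F u ↔ syndromeH F w = 0 ∧ quadS K (α : F) w = 0 := by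
  rw [baseCode, Submodule.mem_inf, LinearMap.mem_ker, LinearMap.mem_ker]
  refine and_congr_right fun h => ?_
  rw [syndromeE_eq hu hK hF α hα he, h]
  have hT : (α : F) + (α : F) ^ 2 ^ u ≠ 0 := fun h0 => by
    rw [← sub_eq_add_of_zmod_two, sub_eq_zero] at h0
    exact pow_two_pow_ne_self hu hF α hα h0.symm
  simp [hT]

section Base

variable {C : Submodule (ZMod 2) (Word F)}

/-- For `h = H v ≠ 0`, the words supported on points `x` and `h + x` have syndrome `h` and `S`-value
`Q(h) + det(h, x)`. A suitable `x` makes this value `S(v)`, which puts a word of weight at most two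
in the coset. Hence weight three forces `H v = 0`. -/
theorem cosetWeight_le_two (he : ∀ x, coords K α x = e x)
    (hC : ∀ w, w ∈ C ↔ syndromeH F w = 0 ∧ quadS K α w = 0)
    {v : Word F} (hv : syndromeH F v ≠ 0) : cosetWeight C v ≤ 2 := by
  set h := syndromeH F v with hh
  obtain ⟨q, hq⟩ := exists_det_eq ((map_ne_zero_iff e e.injective).2 hv)
    ((e h).1 * (e h).2 + quadS K α v)
  let c : Word F := pointWord (e.symm q) + pointWord (h + e.symm q) + v
  have hc : c ∈ C := by
    rw [hC]
    constructor
    · rw [map_add, map_add, syndromeH_pointWord, syndromeH_pointWord, ← hh]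
      have h1 := add_self_eq_zero_of_zmod_two h
      have h2 := add_self_eq_zero_of_zmod_two (e.symm q)
      linear_combination h1 + h2
    · rw [map_add, map_add, quadS_pointWord he, quadS_pointWord he, map_add,
        e.apply_symm_apply, Prod.fst_add, Prod.snd_add]
      have h2 : (2 : K) = 0 := by
        rw [← one_add_one_eq_two, add_self_eq_zero_of_zmod_two]
      linear_combination hq + (q.1 * q.2 + q.1 * (e h).2 - (e h).1 * q.2 + (e h).1 * q.2
        + (e h).1 * (e h).2 - (e h).2 * q.1 + (e h).2 * q.1 + quadS K α v) * h2
  have hle : cosetWeight C v ≤ hammingNorm (c + v) := Nat.sInf_le ⟨c, hc, rfl⟩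
  refine hle.trans ?_
  rw [add_assoc, add_self_eq_zero_of_zmod_two, add_zero]
  exact (hammingNorm_add_le _ _).trans
    (add_le_add (hammingNorm_pointWord_le _) (hammingNorm_pointWord_le _))

/-- Every word in the coset has `H = 0` and `S = b ≠ 0`; it is therefore nonzero, and nonzero words
with `H = 0` have weight at least three. -/
theorem cosetWeight_tripleWord (he : ∀ x, coords K α x = e x)
    (hC : ∀ w, w ∈ C ↔ syndromeH F w = 0 ∧ quadS K α w = 0)
    {b : K} (hb : b ≠ 0) : cosetWeight C (tripleWord e b) = 3 := by
  have hmem : hammingNorm (tripleWord e b) ∈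
      {w : ℕ | ∃ c ∈ C, hammingNorm (c + tripleWord e b) = w} :=
    ⟨0, C.zero_mem, by rw [zero_add]⟩
  refine le_antisymm ((Nat.sInf_le hmem).trans (hammingNorm_tripleWord_le b))
    (le_csInf ⟨_, hmem⟩ ?_)
  · rintro n ⟨c, hc, rfl⟩
    by_contra hlt
    rw [hC] at hc
    have h1 : syndromeH F (c + tripleWord e b) = 0 := by
      rw [map_add, hc.1, syndromeH_tripleWord, add_zero]
    have h2 : quadS K α (c + tripleWord e b) = b := by
      rw [map_add, hc.2, quadS_tripleWord he, zero_add]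
    rw [eq_zero_of_syndromeH_eq_zero h1 (by omega), map_zero] at h2
    exact hb h2.symm

end Base

/-! ### Coset graphs of codes containing the base code -/

theorem exists_cosetGraph_iso {C : Submodule (ZMod 2) (Word F)} {W : Submodule (ZMod 2) K}
    (he : ∀ x, coords K α x = e x)
    (hC : ∀ w, w ∈ C ↔ syndromeH F w = 0 ∧ quadS K α w ∈ W) :
    ∃ ψ : cosetGraph C ≃g altGraph (isNondegAlternating_detForm W),
      ∀ w : Word F, ψ (Submodule.Quotient.mk w) = (e (syndromeH F w),
        W.mkQ (quadS K α w + (e (syndromeH F w)).1 * (e (syndromeH F w)).2)) := by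
  have h2 : (2 : K) = 0 := by
    rw [← one_add_one_eq_two, add_self_eq_zero_of_zmod_two]
  -- Adding `Q(H w)` to `S(w)` turns the adjacency condition `S(w - w') ≡ Q(H w - H w')` into one on
  -- the polar form of `Q`, the determinant.
  let g : Word F → (K × K) × (K ⧸ W) := fun w => (e (syndromeH F w),
        W.mkQ (quadS K α w + (e (syndromeH F w)).1 * (e (syndromeH F w)).2))
  have hg : ∀ w w', g w = g w' ↔ w - w' ∈ C := by
    intro w w'
    rw [hC, map_sub, map_sub, sub_eq_zero, Prod.mk.injEq, e.injective.eq_iff]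
    refine and_congr_right fun h => ?_
    rw [h, ← sub_eq_zero, ← map_sub, add_sub_add_right_eq_sub, Submodule.mkQ_apply,
      Submodule.Quotient.mk_eq_zero]
  let G : Word F ⧸ C → (K × K) × (K ⧸ W) :=
    Quotient.lift g fun w w' h => (hg w w').2 ((Submodule.quotientRel_def C).1 h)
  have hG : ∀ w, G (Submodule.Quotient.mk w) = g w := fun w => rfl
  have hinj : Function.Injective G := by
    intro x y
    obtain ⟨x, rfl⟩ := Submodule.Quotient.mk_surjective C x
    obtain ⟨y, rfl⟩ := Submodule.Quotient.mk_surjective C y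
    rw [hG, hG, hg, Submodule.Quotient.eq]
    exact id
  have hsurj : Function.Surjective G := by
    rintro ⟨p, a⟩
    obtain ⟨b, rfl⟩ := W.mkQ_surjective a
    refine ⟨Submodule.Quotient.mk (tripleWord e b + pointWord (e.symm p)), ?_⟩
    rw [hG]
    have h1 : e (syndromeH F (tripleWord e b + pointWord (e.symm p))) = p := by
      rw [map_add, syndromeH_tripleWord, syndromeH_pointWord, zero_add, e.apply_symm_apply]
    refine Prod.ext h1 ?_
    change W.mkQ _ = W.mkQ b
    rw [h1, map_add (quadS K α), quadS_tripleWord he, quadS_pointWord he, e.apply_symm_apply, add_assoc,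
      add_self_eq_zero_of_zmod_two, add_zero]
  refine ⟨⟨Equiv.ofBijective G ⟨hinj, hsurj⟩, ?_⟩, fun w => rfl⟩
  intro x y
  obtain ⟨x, rfl⟩ := Submodule.Quotient.mk_surjective C x
  obtain ⟨y, rfl⟩ := Submodule.Quotient.mk_surjective C y
  change (g x).1 ≠ (g y).1 ∧ (g x).2 - (g y).2 = detForm W (g x).1 (g y).1 ↔ _
  have key : (g x).2 - (g y).2 = detForm W (g x).1 (g y).1 ↔
      quadS K α (x - y) - (e (syndromeH F (x - y))).1 * (e (syndromeH F (x - y))).2 ∈ W := by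
    change W.mkQ _ - W.mkQ _ = W.mkQ _ ↔ _
    rw [← sub_eq_zero, ← map_sub, ← map_sub, Submodule.mkQ_apply, Submodule.Quotient.mk_eq_zero]
    refine iff_of_eq (congrArg (· ∈ W) ?_)
    change _ - ((e (syndromeH F x)).1 * (e (syndromeH F y)).2
      - (e (syndromeH F x)).2 * (e (syndromeH F y)).1) = _
    rw [map_sub, map_sub, map_sub, Prod.fst_sub, Prod.snd_sub]
    linear_combination ((e (syndromeH F x)).1 * (e (syndromeH F x)).2
      - (e (syndromeH F x)).1 * (e (syndromeH F y)).2) * h2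
  rw [key]
  change e (syndromeH F x) ≠ e (syndromeH F y) ∧ _ ↔ _
  rw [e.injective.ne_iff, ← sub_ne_zero, ← map_sub]
  constructor
  · rintro ⟨h3, h4⟩
    -- The syndrome `H(x - y)` is the only possible position for the single error.
    refine ⟨fun h => h3 ((hC _).1 ((Submodule.Quotient.eq C).1 h)).1, x,
      x - Pi.single (Units.mk0 _ h3) 1, rfl, ?_,
      (hammingDist_eq_one_iff _ _).2 ⟨_, sub_sub_cancel _ _⟩⟩
    rw [Submodule.Quotient.eq, sub_right_comm, hC, map_sub, map_sub (quadS K α),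
      syndromeH_single, quadS_single he]
    exact ⟨sub_self _, h4⟩
  · rintro ⟨-, x', y', hx, hy, hd⟩
    obtain ⟨z, hz⟩ := (hammingDist_eq_one_iff _ _).1 hd
    have hxC := (hC _).1 ((Submodule.Quotient.eq C).1 hx)
    have hyC := (hC _).1 ((Submodule.Quotient.eq C).1 hy)
    have h3 : x - y = Pi.single z 1 - (x' - x) + (y' - y) := by
      rw [← hz]
      abel
    have h4 : syndromeH F (x - y) = z := by
      rw [h3, map_add, map_sub, hxC.1, hyC.1, syndromeH_single, sub_zero, add_zero]
    rw [h4]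
    refine ⟨z.ne_zero, ?_⟩
    rw [h3, map_add, map_sub, quadS_single he, add_sub_right_comm, sub_sub_cancel_left]
    exact W.add_mem (W.neg_mem hxC.2) hyC.2

end Syndromes

/-! ### The nested codes -/

section Nested

variable {F : Type*} [Field F] [Fintype F] [DecidableEq F]
  {K : Type*} [Field K] [Algebra K F] [Algebra (ZMod 2) K]

/-- The space spanned by the first `u - i` of the values `S(v_k)`. -/
def valueSpace (K : Type*) [Field K] [Algebra K F] [Algebra (ZMod 2) K] (α : F) (u : ℕ)
    (v : Fin u → Word F) (i : ℕ) : Submodule (ZMod 2) K :=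
  Submodule.span (ZMod 2) ((fun k => quadS K α (v k)) '' {k : Fin u | (k : ℕ) + i < u})

theorem valueSpace_mono {α : F} {u : ℕ} (v : Fin u → Word F) {i j : ℕ} (hij : j ≤ i) :
    valueSpace K α u v i ≤ valueSpace K α u v j :=
  Submodule.span_mono (Set.image_mono fun k hk => by
    simp only [Set.mem_ofPred_eq] at hk ⊢
    omega)

/-- The generators `v k` have zero first syndrome, so adjoining them only enlarges the set of
allowed values of `S`. -/
theorem mem_nestedCode_iff [Algebra (ZMod 2) F] {α : F} {u : ℕ} {v : Fin u → Word F}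
    (hbase : ∀ w, w ∈ baseCode F u ↔ syndromeH F w = 0 ∧ quadS K α w = 0)
    (hv : ∀ k, syndromeH F (v k) = 0) (i : ℕ) (w : Word F) :
    w ∈ nestedCode u v i ↔ syndromeH F w = 0 ∧ quadS K α w ∈ valueSpace K α u v i := by
  have hmap : valueSpace K α u v i = (Submodule.span (ZMod 2)
      (v '' {k : Fin u | (k : ℕ) + i < u})).map (quadS K α) := by
    rw [valueSpace, Submodule.map_span, Set.image_image]
  have hker : Submodule.span (ZMod 2) (v '' {k : Fin u | (k : ℕ) + i < u})
      ≤ LinearMap.ker (syndromeH F) := by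
    rw [Submodule.span_le]
    rintro _ ⟨k, _, rfl⟩
    exact hv k
  rw [nestedCode, Submodule.mem_sup, hmap]
  constructor
  · rintro ⟨c, hc, d, hd, rfl⟩
    rw [hbase] at hc
    rw [map_add, map_add, hc.1, hc.2, zero_add, zero_add]
    exact ⟨hker hd, d, hd, rfl⟩
  · rintro ⟨h1, d, hd, h2⟩
    refine ⟨w - d, (hbase _).2 ⟨?_, ?_⟩, d, hd, sub_add_cancel _ _⟩
    · rw [map_sub, h1, hker hd, sub_zero]
    · rw [map_sub, h2, sub_self]

variable [Fintype K]

theorem card_valueSpace {α : F} {u : ℕ} {v : Fin u → Word F}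
    (hv : LinearIndependent (ZMod 2) fun k => quadS K α (v k)) (i : ℕ) :
    Nat.card (valueSpace K α u v i) = 2 ^ (u - i) := by
  have hc : Fintype.card {k : Fin u | (k : ℕ) + i < u} = u - i := by
    rw [← Fintype.card_fin (u - i)]
    exact Fintype.card_congr
      { toFun := fun k => ⟨k.1, by have : (k.1 : ℕ) + i < u := k.2; omega⟩
        invFun := fun k => ⟨⟨k, by omega⟩, by
          change (k : ℕ) + i < u
          omega⟩
        left_inv := fun k => rfl
        right_inv := fun k => rfl }
  have h := finrank_span_eq_card
    (hv.comp (Subtype.val : {k : Fin u | (k : ℕ) + i < u} → Fin u) Subtype.val_injective)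
  rw [hc, Set.range_comp, Subtype.range_val] at h
  rw [Module.natCard_eq_pow_finrank (K := ZMod 2), valueSpace, h, Nat.card_zmod]

theorem card_quotient_valueSpace {α : F} {u : ℕ} {v : Fin u → Word F}
    (hK : Fintype.card K = 2 ^ u)
    (hv : LinearIndependent (ZMod 2) fun k => quadS K α (v k)) {i : ℕ} (hi : i ≤ u) :
    Nat.card (K ⧸ valueSpace K α u v i) = 2 ^ i := by
  have h := (valueSpace K α u v i).card_eq_card_quotient_mul_card
  rw [card_valueSpace hv, Nat.card_eq_fintype_card, hK] at h
  have h2 : 2 ^ u = 2 ^ (u - i) * 2 ^ i := by rw [← pow_add, Nat.sub_add_cancel hi]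
  rw [h2] at h
  exact (Nat.eq_of_mul_eq_mul_left (Nat.two_pow_pos _) h).symm

/-- Triple words realise every value of `S`, in particular a basis of `K` over `𝔽₂`. -/
theorem exists_isGeneratingFamily [Algebra (ZMod 2) F] {α : F} {u : ℕ} {e : F ≃+ K × K}
    (hK : Fintype.card K = 2 ^ u) (he : ∀ x, coords K α x = e x)
    (hbase : ∀ w, w ∈ baseCode F u ↔ syndromeH F w = 0 ∧ quadS K α w = 0) :
    ∃ v : Fin u → Word F, IsGeneratingFamily K u α v := by
  have hfin : Module.finrank (ZMod 2) K = u := by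
    have h := Module.natCard_eq_pow_finrank (K := ZMod 2) (V := K)
    rw [Nat.card_eq_fintype_card, hK, Nat.card_zmod] at h
    exact (Nat.pow_right_injective le_rfl h).symm
  let b := Module.finBasisOfFinrankEq (ZMod 2) K hfin
  refine ⟨fun k => tripleWord e (b k), fun k => cosetWeight_tripleWord he hbase (b.ne_zero k), ?_⟩
  simpa only [quadS_tripleWord he] using b.linearIndependent

/-- For `i ≤ 1` the value group has order at most two, and for `i = u` the subspace is zero. The
only remaining case is `u = 3`, `i = 2`, where `K` has eight elements and the subspace two. -/
theorem isDistanceTransitive_valueSpace {α : F} {u : ℕ} {v : Fin u → Word F}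
    (hK : Fintype.card K = 2 ^ u)
    (hv : LinearIndependent (ZMod 2) fun k => quadS K α (v k)) {i : ℕ}
    (hi : i = 0 ∨ i = 1 ∨ i = u ∨ (u = 3 ∧ i ≤ 3)) (hu : 1 ≤ u) :
    IsDistanceTransitive (altGraph (isNondegAlternating_detForm (valueSpace K α u v i))) := by
  by_cases h1 : i ≤ 1
  · refine isDistanceTransitive_detForm_of_card_le_two _ ?_
    rw [card_quotient_valueSpace hK hv (by omega)]
    exact Nat.pow_le_pow_right two_pos h1
  by_cases h2 : i = u
  · have h : valueSpace K α u v i = ⊥ := by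
      rw [Submodule.eq_bot_iff]
      have hc := card_valueSpace hv i
      rw [h2, Nat.sub_self, pow_zero, Nat.card_eq_one_iff_unique] at hc
      intro x hx
      rw [h2] at hx
      have := hc.1
      exact congrArg Subtype.val (Subsingleton.elim (⟨x, hx⟩ : valueSpace K α u v u) 0)
    rw [h]
    exact isDistanceTransitive_detForm_bot
  · have h3 : u = 3 := by omega
    have h4 : i = 2 := by omega
    refine isDistanceTransitive_detForm_of_card_eight (by rw [hK, h3]; rfl) _ ?_
    rw [card_valueSpace hv, h3, h4]
    rfl

end Nested

end NestedCosetGraphs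

end

/-! ### The main theorem -/

open NestedCosetGraphs in
theorem mainTheorem3 (u : ℕ) (hu : 2 ≤ u)
    {K F : Type*} [Field K] [Fintype K] [Field F] [Fintype F] [DecidableEq F]
    [Algebra K F] [Algebra (ZMod 2) K] [Algebra (ZMod 2) F]
    (hK : Fintype.card K = 2 ^ u) (hF : Fintype.card F = 2 ^ (2 * u))
    (α : Fˣ) (hα : ∀ x : Fˣ, x ∈ Subgroup.zpowers α) :
    (∃ v : Fin u → Word F, IsGeneratingFamily K u (α : F) v) ∧
    ∀ v : Fin u → Word F, IsGeneratingFamily K u (α : F) v →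
      -- numbers of vertices
      (∀ i ≤ u, Nat.card (Word F ⧸ nestedCode u v i) = 2 ^ (2 * u + i)) ∧
      -- the graph with index zero
      (Nonempty (nestedGraph u v 0 ≃g (⊤ : SimpleGraph (Fin (2 ^ (2 * u))))) ∧
        (nestedGraph u v 0).ediam = 1) ∧
      -- antipodal distance-regular graphs of diameter three
      (∀ i, 1 ≤ i → i ≤ u →
        (nestedGraph u v i).ediam = 3 ∧
        IsAntipodal (nestedGraph u v i) ∧
        IsDistanceRegular (nestedGraph u v i)
          [2 ^ (2 * u) - 1, 2 ^ (2 * u) - 2 ^ (2 * u - i), 1]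
          [1, 2 ^ (2 * u - i), 2 ^ (2 * u) - 1]) ∧
      -- nestedness: the natural projections of coset spaces are coverings
      (∀ i j, j < i → i ≤ u →
        ∃ h : nestedCode u v i ≤ nestedCode u v j,
          IsGraphCovering (nestedGraph u v i) (nestedGraph u v j)
            (Submodule.factor h) (2 ^ (i - j)) ∧
          (j = 0 → ∀ x y, Submodule.factor h x = Submodule.factor h y ↔
            x = y ∨ (nestedGraph u v i).dist x y = 3)) ∧
      -- distance-transitivity
      (∀ i, i = 0 ∨ i = 1 ∨ i = u ∨ (u = 3 ∧ i ≤ 3) →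
        IsDistanceTransitive (nestedGraph u v i)) := by
  have hu1 : 1 ≤ u := by omega
  obtain ⟨e, he⟩ := exists_coords_addEquiv hu1 hK hF α hα
  have hbase := mem_baseCode_iff hu1 hK hF α hα he
  refine ⟨exists_isGeneratingFamily hK he hbase, fun v ⟨hw, hli⟩ => ?_⟩
  have hv : ∀ k, syndromeH F (v k) = 0 := fun k => by
    by_contra h
    have := cosetWeight_le_two he hbase h
    rw [hw k] at this
    omega
  have hC := fun i => mem_nestedCode_iff hbase hv i
  have hcard := fun {i : ℕ} (hi : i ≤ u) => card_quotient_valueSpace hK hli hi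
  have hfin : ∀ i, Finite (K ⧸ valueSpace K (α : F) u v i) := fun i =>
    Finite.of_surjective _ (Submodule.mkQ_surjective _)
  have hVcard : Nat.card (K × K) = 2 ^ (2 * u) := by
    rw [Nat.card_prod, Nat.card_eq_fintype_card, hK, ← pow_add, two_mul]
  choose ψ hψ using fun i => exists_cosetGraph_iso he (hC i)
  have hntriv : ∀ i, 1 ≤ i → i ≤ u → Nontrivial (K ⧸ valueSpace K (α : F) u v i) :=
    fun i h1 h2 => by
      rw [← Finite.one_lt_card_iff_nontrivial, hcard h2]
      exact Nat.one_lt_two_pow (by omega)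
  have hsub : Subsingleton (K ⧸ valueSpace K (α : F) u v 0) := by
    rw [← Finite.card_le_one_iff_subsingleton, hcard (Nat.zero_le u), pow_zero]
  have hnum : ∀ i ≤ u, Nat.card (Word F ⧸ nestedCode u v i) = 2 ^ (2 * u + i) := fun i hi => by
    rw [Nat.card_congr (ψ i).toEquiv, Nat.card_prod, hVcard, hcard hi, pow_add]
  have hnumV : Nontrivial (Word F ⧸ nestedCode u v 0) := by
    have : Finite (Word F ⧸ nestedCode u v 0) := Finite.of_equiv _ (ψ 0).toEquiv.symm
    rw [← Finite.one_lt_card_iff_nontrivial, hnum 0 (Nat.zero_le u)]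
    exact Nat.one_lt_two_pow (by omega)
  -- For `i = 0` the value group is trivial, so adjacency only says that the first coordinates
  -- differ.
  have htop : nestedGraph u v 0 = ⊤ := by
    ext x y
    rw [SimpleGraph.top_adj]
    refine ⟨fun h => h.ne, fun h => (ψ 0).map_adj_iff.1 ⟨fun h1 => h ?_, Subsingleton.elim _ _⟩⟩
    exact (ψ 0).injective (Prod.ext h1 (Subsingleton.elim _ _))
  refine ⟨hnum, ⟨?_, ?_⟩, ?_, ?_, ?_⟩
  · rw [htop]
    have : Finite (Word F ⧸ nestedCode u v 0) := Finite.of_equiv _ (ψ 0).toEquiv.symm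
    refine ⟨SimpleGraph.Iso.completeGraph (Finite.equivFinOfCardEq ?_)⟩
    rw [hnum 0 (Nat.zero_le u), add_zero]
  · rw [htop, SimpleGraph.ediam_top]
  · intro i h1 h2
    have := hntriv i h1 h2
    refine ⟨(ediam_iso (ψ i)).trans (altGraph.ediam_eq_three _),
      (altGraph.isAntipodal _).of_iso (ψ i), ?_⟩
    have h := altGraph.isDistanceRegular (r := 2 ^ (2 * u - i))
      (isNondegAlternating_detForm (valueSpace K (α : F) u v i))
      (by rw [hVcard, hcard h2, ← pow_add, Nat.sub_add_cancel (by omega)])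
    rw [hVcard] at h
    exact h.of_iso (ψ i)
  · intro i j hji hi
    have hW : valueSpace K (α : F) u v i ≤ valueSpace K (α : F) u v j :=
      valueSpace_mono v hji.le
    have h : nestedCode u v i ≤ nestedCode u v j := fun w hw => by
      rw [hC] at hw ⊢
      exact ⟨hw.1, hW hw.2⟩
    -- The isomorphisms leave the first coordinate alone, so the projection of cosets becomes the
    -- reduction of values from one quotient of `K` to a smaller one.
    have hcomm : ∀ x, ψ j (Submodule.factor h x)
        = Prod.map id (Submodule.factor hW).toAddMonoidHom (ψ i x) := fun x => by
      obtain ⟨w, rfl⟩ := Submodule.Quotient.mk_surjective _ x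
      rw [hψ i w]
      exact hψ j w
    refine ⟨h, ?_, ?_⟩
    · refine IsGraphCovering.of_iso (ψ i) (ψ j) hcomm (altGraph.isGraphCovering _ _ _
        (Submodule.factor_surjective hW) (fun x y => rfl) ?_)
      rw [hcard hi, hcard (hji.le.trans hi), ← pow_add, Nat.sub_add_cancel hji.le]
    · rintro rfl
      exact altGraph.proj_eq_iff _ (ψ i) (ψ 0).injective hcomm
  · intro i hi
    exact (isDistanceTransitive_valueSpace hK hli hi hu1).of_iso (ψ i)
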